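/- Let $n\ge 1$, and let $(x,t)$ and $|x|$ denote the Euclidean scalar product and norm on $\mathbb R^n$. A function $f:\mathbb R^n\to\mathbb C$ belongs to the Wiener algebra $W_0(\mathbb R^n)$ if $f(x)=\int_{\mathbb R^n} g(t)e^{i(x,t)}\,dt$ for all $x$, with some $g\in L_1(\mathbb R^n)$; then $\|f\|_{W_0}=\|g\|_{L_1}$. Let $C_0(\mathbb R^n)$ be the space of continuous functions $f:\mathbb R^n\to\mathbb C$ with $\lim_{|x|\to\infty}f(x)=0$. For a weight $w\ge 0$ put $\|f\|_{L_p(w)}=\left(\int|f|^p w\,dx\right)^{1/p}$ if $0<p<\infty$, and $\|f\|_{L_\infty(w)}=\operatorname{ess\,sup}|f|w$. Fix a real-valued Schwartz function $\varphi$ on $\mathbb R^n$ with $\operatorname{supp}\varphi\subset\{1/2\le|\xi|\le 2\}$, $\varphi(\xi)>0$ for $1/2<|\xi|<2$, and $\sum_{k\in\mathbb Z}\varphi(2^{-k}\xi)=1$ for $\xi\ne 0$, and let $\varphi_k$ be the function with $\int\varphi_k(x)e^{-i(\xi,x)}dx=\varphi(2^{-k}\xi)$. For $f\in C_0(\mathbb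 R^n)$ we say that $f\in\dot B^{s}_{p,\infty}(w)$ if $\|f\|_{\dot B^s_{p,\infty}(w)}=\sup_{k\in\mathbb Z}2^{sk}\|\varphi_k*f\|_{L_p(w)}<\infty$. **Theorem.** Let either $0<q<2<r\le\infty$ or $0<r<2<q\le\infty$ (with $1/\infty=0$), and let $\sigma,s\in\mathbb R$, $\sigma<s$. Let $u,v:\mathbb R^n\to\mathbb R$ be measurable functions with $u(x)v(x)\ge 1$ for all $x$, such that * if $q<2$, then $\sigma-\frac n2<n\left(\frac1q-\frac12\right)$ and $u(x)\ge 1$ for all $x$; * if $r<2$, then $n\left(\frac1r-\frac12\right)<s-\frac n2$ and $v(x)\ge 1$ for all $x$; * $\frac{1-\theta}{q}+\frac{\theta}{r}>\frac12$, where $\theta=\frac{n/2-\sigma}{s-\sigma}$. Let $\gamma=\frac{2-q}{r-q}$ if $q<2$, and $\gamma=\frac{q-2}{q-r}$ if $r<2$. Put $U=u^{1/(1-\gamma)}$ and $V=v^{1/\gamma}$, except that, for an infinite exponent, $V=v^{1/(2-q)}$ if $r=\infty$ and $U=u^{1/(2-r)}$ if $q=\infty$. If $f\in C_0(\mathbb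 R^n)$ and $$f\in\dot B^{\sigma}_{q,\infty}(U)\cap\dot B^{s}_{r,\infty}(V),$$ then $f\in W_0(\mathbb R^n)$. If, in addition, $s-\frac nr\ne\sigma-\frac nq$, then $$\|f\|_{W_0}\le C\,\|f\|_{\dot B^{\sigma}_{q,\infty}(U)}^{1-\delta}\,\|f\|_{\dot B^{s}_{r,\infty}(V)}^{\delta},\qquad \delta=\frac{\frac nq-\sigma}{s-\sigma+n\left(\frac1q-\frac1r\right)},$$ where $C$ is a constant independent of $f$. -/

import Mathlib

open MeasureTheory
open scoped ENNReal NNReal SchwartzMap ZeroAtInfty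

noncomputable section

namespace WienerBesov

/-- The Euclidean space `ℝⁿ`. -/
abbrev Rn (n : ℕ) : Type := EuclideanSpace ℝ (Fin n)

/-- The character `t ↦ e^{i(x,t)}`. -/
def char {n : ℕ} (x t : Rn n) : ℂ :=
  Complex.exp (Complex.I * ((inner ℝ x t : ℝ) : ℂ))

/-! ### The Wiener algebra -/

/-- `g ∈ L₁(ℝⁿ)` represents `f` as an absolutely convergent Fourier integral,
`f(x) = ∫ g(t) e^{i(x,t)} dt` for every `x`. -/
def Represents {n : ℕ} (g f : Rn n → ℂ) : Prop :=
  Integrable g ∧ ∀ x, f x = ∫ t, g t * char x t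

/-- `f ∈ W₀(ℝⁿ)`. -/
def MemWiener {n : ℕ} (f : Rn n → ℂ) : Prop :=
  ∃ g : Rn n → ℂ, Represents g f

/-- `‖f‖_{W₀} = ‖g‖_{L₁}` for the (almost everywhere unique) representing `g`;
the value is `∞` when `f ∉ W₀(ℝⁿ)`. -/
def wienerNorm {n : ℕ} (f : Rn n → ℂ) : ℝ≥0∞ :=
  ⨅ (g : Rn n → ℂ) (_ : Represents g f), ∫⁻ t, ‖g t‖ₑ

/-! ### Weighted Lebesgue and homogeneous Besov quasi-norms -/

/-- The quasi-norm of `L_p(ℝⁿ, w)`, with values in `[0, ∞]`: `(∫ |g|^p w)^{1/p}` for `p < ∞`,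
and `ess sup |g| w` for `p = ∞`. -/
def weightedLpNorm {n : ℕ} (p : ℝ≥0∞) (w : Rn n → ℝ) (g : Rn n → ℂ) : ℝ≥0∞ :=
  if p = ⊤ then essSup (fun x => ‖g x‖ₑ * ENNReal.ofReal (w x)) volume
  else (∫⁻ x, ‖g x‖ₑ ^ p.toReal * ENNReal.ofReal (w x)) ^ (1 / p.toReal)

/-- `φ` generates a dyadic resolution of unity on `ℝⁿ ∖ {0}`. -/
structure IsDyadicGenerator {n : ℕ} (φ : 𝓢(Rn n, ℝ)) : Prop where
  tsupport_subset : tsupport φ ⊆ {ξ | 1 / 2 ≤ ‖ξ‖ ∧ ‖ξ‖ ≤ 2}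
  pos : ∀ ξ, 1 / 2 < ‖ξ‖ → ‖ξ‖ < 2 → 0 < φ ξ
  hasSum_one : ∀ ξ, ξ ≠ 0 → HasSum (fun k : ℤ => φ ((2 : ℝ) ^ (-k) • ξ)) 1

/-- The function `φ_k` whose Fourier transform `∫ φ_k(x) e^{-i(ξ,x)} dx` is `φ(2^{-k} ξ)`,
that is, `φ_k(x) = (2π)^{-n} ∫ φ(2^{-k} ξ) e^{i(x,ξ)} dξ`. -/
def dyadicKernel {n : ℕ} (φ : 𝓢(Rn n, ℝ)) (k : ℤ) (x : Rn n) : ℂ :=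
  (((2 * Real.pi) ^ n)⁻¹ : ℝ) * ∫ ξ, (φ ((2 : ℝ) ^ (-k) • ξ) : ℂ) * char x ξ

/-- The dyadic block `φ_k * f`, i.e. `x ↦ ∫ φ_k(y) f(x - y) dy`. -/
def dyadicBlock {n : ℕ} (φ : 𝓢(Rn n, ℝ)) (k : ℤ) (f : Rn n → ℂ) : Rn n → ℂ :=
  convolution (dyadicKernel φ k) f (ContinuousLinearMap.mul ℝ ℂ) volume

/-- The quasi-norm of the weighted homogeneous Besov space with third index `∞`,
`sup_{k ∈ ℤ} 2^{sk} ‖φ_k * f‖_{L_p(w)}`, with values in `[0, ∞]`. -/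
def besovNorm {n : ℕ} (φ : 𝓢(Rn n, ℝ)) (p : ℝ≥0∞) (s : ℝ) (w : Rn n → ℝ)
    (f : Rn n → ℂ) : ℝ≥0∞ :=
  ⨆ k : ℤ, ENNReal.ofReal ((2 : ℝ) ^ (s * (k : ℝ))) * weightedLpNorm p w (dyadicBlock φ k f)

/-- `f` belongs to the weighted homogeneous Besov space with third index `∞`. -/
def MemBesov {n : ℕ} (φ : 𝓢(Rn n, ℝ)) (p : ℝ≥0∞) (s : ℝ) (w : Rn n → ℝ)
    (f : Rn n → ℂ) : Prop :=
  besovNorm φ p s w f < ⊤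

/-! ### Parameters and weights -/

/-- The reciprocal `1/q` of a positive exponent, with `1/∞ = 0`. -/
def recip (q : ℝ≥0∞) : ℝ := (q⁻¹).toReal

/-- `γ(p,q,r)`: `(p-q)/(r-q)` when `q < p` (so `0` when `r = ∞`) and `(q-p)/(q-r)` when `r < p`
(so `1` when `q = ∞`). -/
def gam (p : ℝ) (q r : ℝ≥0∞) : ℝ :=
  if q < ENNReal.ofReal p then
    if r = ⊤ then 0 else (p - q.toReal) / (r.toReal - q.toReal)
  else
    if q = ⊤ then 1 else (q.toReal - p) / (q.toReal - r.toReal)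

/-- The weight written `u^{1/(1-γ)}` in `L_q(u^{1/(1-γ)})`, for `γ = γ(p,q,r)`. When `q = ∞`,
`1 - γ = 0`, and the weight is the one for which the `L_∞` quasi-norm is the limit of the `L_q`
quasi-norms: for finite `q` the latter is the `L_q` quasi-norm of `|g| u^{1/(q(1-γ))}`,
where `q (1-γ) = (p-r) · q/(q-r)`, and `q/(q-r)` is read as `1` for `q = ∞`. -/
def weightU {n : ℕ} (p : ℝ) (q r : ℝ≥0∞) (u : Rn n → ℝ) (x : Rn n) : ℝ :=
  if q = ⊤ then u x ^ (1 / (p - r.toReal)) else u x ^ (1 / (1 - gam p q r))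

/-- The weight written `v^{1/γ}` in `L_r(v^{1/γ})`, for `γ = γ(p,q,r)`. When `r = ∞`, `γ = 0`, and
the weight is again the limiting one: `r γ = (p-q) · r/(r-q)`, with `r/(r-q)` read as `1`. -/
def weightV {n : ℕ} (p : ℝ) (q r : ℝ≥0∞) (v : Rn n → ℝ) (x : Rn n) : ℝ :=
  if r = ⊤ then v x ^ (1 / (p - q.toReal)) else v x ^ (1 / gam p q r)

/-- `θ = (τ - σ)/(s - σ)`. -/
def theta (τ σ s : ℝ) : ℝ := (τ - σ) / (s - σ)

/-- The exponent `δ = (n/q - σ)/(s - σ + n (1/q - 1/r))`. -/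
def delta (n : ℕ) (q r : ℝ≥0∞) (σ s : ℝ) : ℝ :=
  (n * recip q - σ) / (s - σ + n * (recip q - recip r))

end WienerBesov

end

/-! The function `f` is recovered as the sum of its dyadic blocks `φ_k * f`. Each block has spectrum
in an annulus of radius about `2^k`, so Plancherel and Cauchy–Schwarz bound its Wiener norm by a
constant times `2^{kn/2} ‖φ_k * f‖_2`. It remains to sum these numbers over `k`
(`exists_wienerNorm_le_tsum`).

Let `q < 2 < r`, let `A` and `B` be the Besov quasi-norms with indices `(q, σ)` and `(r, s)`, and
choose `η` with `(1-η)/q + η/r = 1/2`. The `k`-th number has two bounds. Nikolskii's inequality and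
`u ≥ 1` give `C A 2^{k e₁}` with `e₁ = n/q - σ` (`exists_bernstein`). Hölder's inequality and `uv ≥
1` give `A^{1-η} B^η 2^{k e₂}` with `e₂ = n/2 - (1-η)σ - ηs` (`eLpNorm_two_le_weighted`). The
hypotheses make `e₁ > 0 > e₂`, the second sign because the condition on `θ` means `θ < η` and `e₂ =
(θ-η)(s-σ)`. The sum is thus dominated by two geometric progressions of opposite directions. It is
comparable to its value where they cross, and that value produces the exponent `δ`
(`exists_tsum_le_of_opposite`).

The case `r < 2 < q` is the same argument with the two spaces interchanged. Both signs are then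
reversed, which is why `exists_wienerNorm_le` does not order `σ` and `s`. -/

open Filter Topology
open scoped FourierTransform Convolution

namespace WienerBesov

variable {n : ℕ}

/-! ### Dilated multipliers and their kernels -/

/-- The dilation `ξ ↦ m (c ξ)` of a Schwartz function. -/
noncomputable def dilate (c : ℝˣ) (m : 𝓢(Rn n, ℂ)) : 𝓢(Rn n, ℂ) :=
  SchwartzMap.compCLMOfContinuousLinearEquiv ℂ (ContinuousLinearEquiv.smulLeft (R₁ := ℝ) c) m

@[simp] lemma dilate_apply (c : ℝˣ) (m : 𝓢(Rn n, ℂ)) (ξ : Rn n) :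
    dilate c m ξ = m ((c : ℝ) • ξ) := rfl

/-- The dilation factor `2π 2^{-k}` of the `k`-th dyadic block in the frequency variable of
Mathlib's Fourier transform. -/
noncomputable def freq (k : ℤ) : ℝˣ :=
  Units.mk0 ((2 : ℝ) ^ (-k) * (2 * Real.pi)) (by positivity)

lemma freq_val (k : ℤ) : (freq k : ℝ) = (2 : ℝ) ^ (-k) * (2 * Real.pi) := rfl

lemma freq_pos (k : ℤ) : 0 < (freq k : ℝ) := by rw [freq_val]; positivity

lemma freq_sub_one (k : ℤ) : (freq (k - 1) : ℝ) = 2 * freq k := by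
  rw [freq_val, freq_val, neg_sub, sub_eq_add_neg, zpow_add₀ two_ne_zero, zpow_one]
  ring

/-- A real Schwartz function regarded as complex-valued. -/
noncomputable def toComplex (φ : 𝓢(Rn n, ℝ)) : 𝓢(Rn n, ℂ) :=
  SchwartzMap.postcompCLM Complex.ofRealCLM φ

@[simp] lemma toComplex_apply (φ : 𝓢(Rn n, ℝ)) (ξ : Rn n) : toComplex φ ξ = (φ ξ : ℂ) := rfl

/-- The convolution kernel of a Fourier multiplier. -/
noncomputable abbrev kernel (m : 𝓢(Rn n, ℂ)) : 𝓢(Rn n, ℂ) := 𝓕⁻ m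

/-- The convolution of complex-valued functions on `ℝⁿ`. -/
noncomputable abbrev conv (f g : Rn n → ℂ) : Rn n → ℂ :=
  convolution f g (ContinuousLinearMap.mul ℝ ℂ) volume

/-- The substitution `ξ ↦ 2πξ` absorbs the factor `(2π)^{-n}` and turns `e^{i(x,ξ)}` into
`e^{2πi(x,ξ)}`; this accounts for the `2π` in `freq`. -/
lemma dyadicKernel_eq (φ : 𝓢(Rn n, ℝ)) (k : ℤ) :
    dyadicKernel φ k = kernel (dilate (freq k) (toComplex φ)) := by
  ext x
  rw [SchwartzMap.fourierInv_coe, Real.fourierInv_eq']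
  have h := Measure.integral_comp_smul (volume : Measure (Rn n))
    (fun ξ : Rn n => (φ ((2 : ℝ) ^ (-k) • ξ) : ℂ) * char x ξ) (2 * Real.pi)
  rw [abs_of_nonneg (by positivity), finrank_euclideanSpace_fin] at h
  rw [dyadicKernel, ← Complex.real_smul, ← h]
  refine integral_congr_ae (ae_of_all _ fun ξ => ?_)
  simp only [char, dilate_apply, toComplex_apply, freq_val, smul_smul, smul_eq_mul,
    real_inner_smul_right, real_inner_comm x ξ]
  rw [mul_comm]
  push_cast
  ring_nf

lemma conv_apply (f g : Rn n → ℂ) (x : Rn n) :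
    conv f g x = ∫ y, f y * g (x - y) := rfl

/-- The kernel of a dilated multiplier acts as a dilated kernel. -/
lemma conv_dilate (c : ℝˣ) (hc : 0 < (c : ℝ)) (m : 𝓢(Rn n, ℂ)) (f : Rn n → ℂ) (x : Rn n) :
    conv (kernel (dilate c m)) f x =
      ∫ y, kernel m y * f (x - (c : ℝ) • y) := by
  have key : ∀ y, kernel m y = ((c : ℝ) ^ n : ℝ) • kernel (dilate c m) ((c : ℝ) • y) := by
    intro y
    rw [SchwartzMap.fourierInv_coe, SchwartzMap.fourierInv_coe, Real.fourierInv_eq',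
      Real.fourierInv_eq']
    have h := Measure.integral_comp_smul (volume : Measure (Rn n))
      (fun v : Rn n => Complex.exp (↑(2 * Real.pi * inner ℝ v y) * Complex.I) • m v) c
    rw [abs_of_nonneg (by positivity), finrank_euclideanSpace_fin] at h
    simp only [dilate_apply, real_inner_smul_right, real_inner_smul_left] at h ⊢
    rw [h, smul_smul, mul_inv_cancel₀ (by positivity), one_smul]
  have h := Measure.integral_comp_smul (volume : Measure (Rn n))
    (fun y : Rn n => kernel (dilate c m) y * f (x - y)) c
  rw [abs_of_nonneg (by positivity), finrank_euclideanSpace_fin] at h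
  simp only [key, smul_mul_assoc]
  rw [integral_smul, h, smul_smul, mul_inv_cancel₀ (by positivity), one_smul,
    conv_apply]

/-- Convolution with the kernels of dilated multipliers passes to the limit pointwise. -/
lemma tendsto_conv_dilate {ι : Type*} {l : Filter ι} [l.IsCountablyGenerated]
    (c : ι → ℝˣ) (hc : ∀ i, 0 < (c i : ℝ)) (m : 𝓢(Rn n, ℂ)) (f : C₀(Rn n, ℂ)) (x : Rn n)
    (a : ℂ) (h : ∀ᵐ y, Tendsto (fun i => f (x - (c i : ℝ) • y)) l (𝓝 a)) :
    Tendsto (fun i => conv (kernel (dilate (c i) m)) f x)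
      l (𝓝 (m 0 * a)) := by
  simp only [conv_dilate _ (hc _)]
  -- The total mass of the kernel is the value of its Fourier transform at the origin.
  have hm : m 0 * a = ∫ y, kernel m y * a := by
    rw [integral_mul_const]
    congr 1
    have : m 0 = (𝓕 (𝓕⁻ m)) 0 := by rw [FourierTransform.fourier_fourierInv_eq]
    rw [this, SchwartzMap.fourier_coe, Real.fourier_eq']
    simp
  rw [hm]
  refine tendsto_integral_filter_of_dominated_convergence (fun y => ‖kernel m y‖ * ‖f.toBCF‖) ?_ ?_ ?_ ?_
  · refine Eventually.of_forall fun i => ?_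
    exact ((kernel m).continuous.mul (f.continuous.comp (by fun_prop))).aestronglyMeasurable
  · refine Eventually.of_forall fun i => ae_of_all _ fun y => ?_
    rw [norm_mul]
    gcongr
    exact f.toBCF.norm_coe_le_norm _
  · exact (kernel m).integrable.norm.mul_const _
  · filter_upwards [h] with y hy using hy.const_mul _

/-- The kernels spread out: for `y ≠ 0` the points `x - c y` escape to infinity, where `f` vanishes.
The assumption `1 ≤ n` makes the exceptional point `y = 0` a null set. -/
lemma tendsto_conv_freq_neg (hn : 1 ≤ n) (m : 𝓢(Rn n, ℂ)) (f : C₀(Rn n, ℂ)) (x : Rn n) :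
    Tendsto (fun N : ℕ => conv (kernel (dilate (freq (-(N : ℤ))) m)) f x) atTop (𝓝 0) := by
  have : Nontrivial (Rn n) := by
    apply Module.nontrivial_of_finrank_pos (R := ℝ); rw [finrank_euclideanSpace_fin]; omega
  have hc : Tendsto (fun N : ℕ => (freq (-(N : ℤ)) : ℝ)) atTop atTop := by
    simp only [freq_val, neg_neg, zpow_natCast]
    exact (tendsto_pow_atTop_atTop_of_one_lt one_lt_two).atTop_mul_const (by positivity)
  have := tendsto_conv_dilate (l := atTop) (fun N : ℕ => freq (-(N : ℤ)))
    (fun _ => freq_pos _) m f x 0 ?_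
  · simpa using this
  · filter_upwards [compl_mem_ae_iff.2 (measure_singleton (0 : Rn n))] with y hy
    have hy : y ≠ 0 := hy
    refine (zero_at_infty f).comp ?_
    rw [← Metric.cobounded_eq_cocompact]
    rw [← tendsto_norm_atTop_iff_cobounded]
    have h2 : Tendsto (fun N : ℕ => (freq (-(N : ℤ)) : ℝ) * ‖y‖ - ‖x‖) atTop atTop :=
      tendsto_atTop_add_const_right _ _ (hc.atTop_mul_const (norm_pos_iff.2 hy))
    refine tendsto_atTop_mono (fun N => ?_) h2
    have := norm_sub_norm_le ((freq (-(N : ℤ)) : ℝ) • y) x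
    rw [norm_smul, Real.norm_of_nonneg (freq_pos _).le, norm_sub_rev] at this
    exact this

lemma tendsto_conv_freq (m : 𝓢(Rn n, ℂ)) (f : C₀(Rn n, ℂ)) (x : Rn n) :
    Tendsto (fun N : ℕ => conv (kernel (dilate (freq (N : ℤ)) m)) f x) atTop (𝓝 (m 0 * f x)) := by
  refine tendsto_conv_dilate _ (fun _ => freq_pos _) m f x _ (ae_of_all _ fun y => ?_)
  have hc : Tendsto (fun N : ℕ => (freq (N : ℤ) : ℝ)) atTop (𝓝 0) := by
    have := (tendsto_pow_atTop_nhds_zero_of_lt_one (r := (2 : ℝ)⁻¹) (by norm_num)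
      (by norm_num)).mul_const (2 * Real.pi)
    simpa [freq_val] using this
  have h2 : Tendsto (fun N : ℕ => x - (freq (N : ℤ) : ℝ) • y) atTop (𝓝 x) := by
    simpa using (hc.smul_const y).const_sub x
  exact (f.continuous.tendsto x).comp h2

/-! ### The dyadic resolution of unity -/

namespace IsDyadicGenerator

variable {φ : 𝓢(Rn n, ℝ)}

/-- The support condition gives vanishing inside the open ball; continuity along the ray through `ξ`
adds the boundary sphere. -/
lemma eq_zero_of_norm_le (hφ : IsDyadicGenerator φ) {ξ : Rn n} (h : ‖ξ‖ ≤ 1 / 2) : φ ξ = 0 := by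
  have hcl : IsClosed {t : ℝ | φ (t • ξ) = 0} :=
    isClosed_eq (φ.continuous.comp (by fun_prop)) continuous_const
  have hsub : Set.Ico (0 : ℝ) 1 ⊆ {t : ℝ | φ (t • ξ) = 0} := by
    intro t ht
    refine image_eq_zero_of_notMem_tsupport fun hmem => ?_
    have h1 := (hφ.tsupport_subset hmem).1
    rw [norm_smul, Real.norm_of_nonneg ht.1] at h1
    nlinarith [norm_nonneg ξ, ht.1, ht.2]
  have h1 := hcl.closure_subset_iff.2 hsub
  rw [closure_Ico zero_ne_one] at h1
  simpa using h1 (Set.right_mem_Icc.2 zero_le_one)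

lemma eq_zero_of_le_norm (hφ : IsDyadicGenerator φ) {ξ : Rn n} (h : 2 ≤ ‖ξ‖) : φ ξ = 0 := by
  have hcl : IsClosed {t : ℝ | φ (t • ξ) = 0} :=
    isClosed_eq (φ.continuous.comp (by fun_prop)) continuous_const
  have hsub : Set.Ioi (1 : ℝ) ⊆ {t : ℝ | φ (t • ξ) = 0} := by
    intro t ht
    refine image_eq_zero_of_notMem_tsupport fun hmem => ?_
    have ht : 1 < t := ht
    have h1 := (hφ.tsupport_subset hmem).2
    rw [norm_smul, Real.norm_of_nonneg (by linarith)] at h1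
    nlinarith
  have h1 := hcl.closure_subset_iff.2 hsub
  rw [closure_Ioi] at h1
  simpa using h1 (Set.self_mem_Ici)

/-- In the resolution of unity, `k ≥ 1` moves `ξ` into the ball of radius `1/2` and `k ≤ -2` moves
it to norm at least `2`, so only `k = 0` and `k = -1` survive. -/
lemma add_eq_one (hφ : IsDyadicGenerator φ) {ξ : Rn n} (h : 1 / 2 ≤ ‖ξ‖) (h' : ‖ξ‖ ≤ 1) :
    φ ξ + φ ((2 : ℝ) • ξ) = 1 := by
  have hξ : ξ ≠ 0 := by rintro rfl; norm_num at h
  have h1 : HasSum (fun k : ℤ => φ ((2 : ℝ) ^ (-k) • ξ))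
      (∑ k ∈ ({0, -1} : Finset ℤ), φ ((2 : ℝ) ^ (-k) • ξ)) := by
    refine hasSum_sum_of_ne_finset_zero fun k hk => ?_
    have hk : k ≠ 0 ∧ k ≠ -1 := by simpa using hk
    rcases lt_or_ge 0 k with hpos | hneg
    · apply hφ.eq_zero_of_norm_le
      rw [norm_smul, norm_zpow, Real.norm_of_nonneg zero_le_two]
      have : (2 : ℝ) ^ (-k) ≤ 2 ^ (-1 : ℤ) := zpow_le_zpow_right₀ one_le_two (by omega)
      rw [zpow_neg_one] at this
      nlinarith
    · apply hφ.eq_zero_of_le_norm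
      rw [norm_smul, norm_zpow, Real.norm_of_nonneg zero_le_two]
      have : (2 : ℝ) ^ (2 : ℤ) ≤ 2 ^ (-k) := zpow_le_zpow_right₀ one_le_two (by omega)
      norm_num at this
      have h4 : (4 : ℝ) ≤ 2 ^ (-k) := by simpa using this
      nlinarith
  have h2 := h1.unique (hφ.hasSum_one ξ hξ)
  simpa using h2

/-- The low-pass multiplier `∑_{k ≤ 0} φ(2^{-k} ξ)`, extended by `1` to the origin. -/
lemma exists_lowPass (hφ : IsDyadicGenerator φ) :
    ∃ ψ : 𝓢(Rn n, ℂ), ψ 0 = 1 ∧ (∀ ξ, (φ ξ : ℂ) = ψ ξ - ψ ((2 : ℝ) • ξ)) ∧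
      ∀ ξ, ψ ((1 / 2 : ℝ) • ξ) * φ ξ = φ ξ := by
  let g : Rn n → ℂ := fun ξ => if ‖ξ‖ < 1 then 1 else (φ ξ : ℂ)
  have hg1 : ∀ ξ, ‖ξ‖ ≤ 1 → g ξ = 1 := by
    intro ξ hξ
    rcases hξ.lt_or_eq with h | h
    · simp [g, h]
    · have h1 := hφ.add_eq_one (ξ := ξ) (by linarith) (by linarith)
      rw [hφ.eq_zero_of_le_norm (ξ := (2 : ℝ) • ξ) (by rw [norm_smul]; norm_num; linarith)] at h1
      simp only [g, h, lt_irrefl, if_false]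
      rw [add_zero] at h1
      rw [h1]; norm_num
  have hg2 : ∀ ξ, 1 ≤ ‖ξ‖ → g ξ = φ ξ := by
    intro ξ hξ
    simp [g, not_lt.2 hξ]
  -- The two pieces of `g` meet on the unit sphere. This formula holds on both sides of it and shows
  -- that the gluing is smooth.
  have hg3 : ∀ ξ, 1 / 2 ≤ ‖ξ‖ → g ξ = φ ξ + φ ((2 : ℝ) • ξ) := by
    intro ξ hξ
    rcases le_or_gt ‖ξ‖ 1 with h | h
    · rw [hg1 ξ h, ← Complex.ofReal_add, hφ.add_eq_one hξ h, Complex.ofReal_one]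
    · rw [hg2 ξ h.le, hφ.eq_zero_of_le_norm (ξ := (2 : ℝ) • ξ)
        (by rw [norm_smul]; norm_num; linarith)]
      simp
  have hsmooth : ContDiff ℝ ((⊤ : ℕ∞) : WithTop ℕ∞) g := by
    rw [contDiff_iff_contDiffAt]
    intro ξ
    have hφc : ContDiff ℝ ((⊤ : ℕ∞) : WithTop ℕ∞) fun ξ => (φ ξ : ℂ) :=
      Complex.ofRealCLM.contDiff.comp (φ.smooth ⊤)
    rcases lt_or_ge ‖ξ‖ 1 with h | h
    · refine (contDiffAt_const (c := (1 : ℂ))).congr_of_eventuallyEq ?_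
      filter_upwards [(isOpen_lt continuous_norm continuous_const).mem_nhds h] with η hη
      exact hg1 η (le_of_lt hη)
    · have h2 : ContDiff ℝ ((⊤ : ℕ∞) : WithTop ℕ∞)
          fun ξ => (φ ξ : ℂ) + (φ ((2 : ℝ) • ξ) : ℂ) :=
        hφc.add (hφc.comp (contDiff_const_smul (2 : ℝ)))
      refine h2.contDiffAt.congr_of_eventuallyEq ?_
      have h3 : (1 / 2 : ℝ) < ‖ξ‖ := by linarith
      filter_upwards [(isOpen_lt continuous_const continuous_norm).mem_nhds h3] with η hη
      exact hg3 η (le_of_lt hη)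
  have hsupp : HasCompactSupport g := by
    refine HasCompactSupport.of_support_subset_isCompact (isCompact_closedBall (0 : Rn n) 2) ?_
    intro ξ hξ
    by_contra hcon
    have h2 : 2 < ‖ξ‖ := by simpa using hcon
    apply hξ
    rw [hg2 ξ (by linarith), hφ.eq_zero_of_le_norm h2.le, Complex.ofReal_zero]
  refine ⟨hsupp.toSchwartzMap hsmooth, hg1 0 (by simp), fun ξ => ?_, fun ξ => ?_⟩
  · change (φ ξ : ℂ) = g ξ - g ((2 : ℝ) • ξ)
    have h2 : ‖(2 : ℝ) • ξ‖ = 2 * ‖ξ‖ := by rw [norm_smul]; norm_num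
    rcases le_or_gt ‖ξ‖ (1 / 2) with h | h
    · rw [hg1 ξ (by linarith), hg1 _ (by linarith), hφ.eq_zero_of_norm_le h]
      simp
    · rw [hg3 ξ h.le, hg2 _ (by linarith)]
      ring
  · change g ((1 / 2 : ℝ) • ξ) * φ ξ = φ ξ
    have h2 : ‖(1 / 2 : ℝ) • ξ‖ = 1 / 2 * ‖ξ‖ := by rw [norm_smul]; norm_num
    rcases le_or_gt ‖ξ‖ 2 with h | h
    · rw [hg1 _ (by linarith), one_mul]
    · rw [hφ.eq_zero_of_le_norm h.le]
      simp

end IsDyadicGenerator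

/-! ### Convolution with bounded continuous functions -/

lemma integrable_schwartz_mul (K : 𝓢(Rn n, ℂ)) {g : Rn n → ℂ} (hg : Continuous g) {M : ℝ}
    (hM : ∀ x, ‖g x‖ ≤ M) : Integrable fun y => K y * g y :=
  K.integrable.mul_bdd hg.aestronglyMeasurable (ae_of_all _ hM)

lemma bddAbove_range_norm {g : Rn n → ℂ} {M : ℝ} (hM : ∀ x, ‖g x‖ ≤ M) :
    BddAbove (Set.range fun x => ‖g x‖) := ⟨M, by rintro _ ⟨x, rfl⟩; exact hM x⟩

lemma continuous_conv_schwartz (K : 𝓢(Rn n, ℂ)) {g : Rn n → ℂ} (hg : Continuous g) {M : ℝ}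
    (hM : ∀ x, ‖g x‖ ≤ M) : Continuous (conv K g) :=
  BddAbove.continuous_convolution_right_of_integrable _ (bddAbove_range_norm hM) K.integrable hg

lemma norm_conv_schwartz_le (K : 𝓢(Rn n, ℂ)) {g : Rn n → ℂ} {M : ℝ}
    (hM : ∀ x, ‖g x‖ ≤ M) (x : Rn n) : ‖conv K g x‖ ≤ (∫ y, ‖K y‖) * M := by
  rw [conv_apply, ← integral_mul_const]
  refine norm_integral_le_of_norm_le (K.integrable.norm.mul_const M) (ae_of_all _ fun y => ?_)
  rw [norm_mul]
  gcongr
  exact hM _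

lemma conv_sub_left (K L : 𝓢(Rn n, ℂ)) {g : Rn n → ℂ} (hg : Continuous g) {M : ℝ}
    (hM : ∀ x, ‖g x‖ ≤ M) (x : Rn n) : conv (K - L : 𝓢(Rn n, ℂ)) g x = conv K g x - conv L g x := by
  have h : ∀ K : 𝓢(Rn n, ℂ), Integrable fun y => K y * g (x - y) := fun K =>
    integrable_schwartz_mul K (g := fun y => g (x - y)) (by fun_prop) fun y => hM _
  simp only [conv_apply]
  rw [← integral_sub (h K) (h L)]
  simp only [sub_apply, sub_mul]

/-- A multiplier equal to `1` where `m` does not vanish reproduces the functions filtered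
by `m`. -/
lemma conv_kernel_conv_kernel {χ m : 𝓢(Rn n, ℂ)} (h : ∀ ξ, χ ξ * m ξ = m ξ)
    {g : Rn n → ℂ} (hg : Continuous g) {M : ℝ} (hM : ∀ x, ‖g x‖ ≤ M) :
    conv (kernel χ) (conv (kernel m) g) = conv (kernel m) g := by
  -- The identity is checked on the Fourier side for Schwartz kernels only; associativity of
  -- convolution then carries it over to the merely bounded `g`.
  have hK : conv (kernel χ) (kernel m) = kernel m := by
    ext x
    have h1 := SchwartzMap.convolution_apply (ContinuousLinearMap.mul ℂ ℂ) (kernel χ) (kernel m) x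
    have h2 : SchwartzMap.convolution (ContinuousLinearMap.mul ℂ ℂ) (kernel χ) (kernel m)
        = kernel m := by
      apply (FourierTransform.fourierEquiv ℂ 𝓢(Rn n, ℂ)).injective
      rw [FourierTransform.fourierEquiv_apply, FourierTransform.fourierEquiv_apply]
      rw [SchwartzMap.fourier_convolution]
      ext ξ
      rw [SchwartzMap.pairing_apply_apply]
      simp [kernel, h]
    rw [h2] at h1
    exact h1.symm
  ext x
  have hassoc := convolution_assoc (f := kernel χ) (g := kernel m) (k := g)
    (μ := (volume : Measure (Rn n))) (ν := volume)
    (ContinuousLinearMap.mul ℝ ℂ) (ContinuousLinearMap.mul ℝ ℂ) (ContinuousLinearMap.mul ℝ ℂ)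
    (ContinuousLinearMap.mul ℝ ℂ) (fun x y z => by simp [mul_assoc]) (x₀ := x)
    (kernel χ).continuous.aestronglyMeasurable (kernel m).continuous.aestronglyMeasurable
    hg.aestronglyMeasurable ?_ ?_ ?_
  · change conv (conv (kernel χ) (kernel m)) g x = conv (kernel χ) (conv (kernel m) g) x at hassoc
    rw [hK] at hassoc
    exact hassoc.symm
  · exact (kernel χ).integrable.ae_convolution_exists _ (kernel m).integrable
  · refine ae_of_all _ fun x => ?_
    exact (kernel m).integrable.norm.mul_bdd
      (g := fun y => ‖g (x - y)‖) (c := M) (by fun_prop) (ae_of_all _ fun y => by simpa using hM _)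
  · have hc : Continuous (convolution (fun x => ‖kernel m x‖) (fun x => ‖g x‖)
        (ContinuousLinearMap.mul ℝ ℝ) volume) :=
      BddAbove.continuous_convolution_right_of_integrable _
        (by simpa using bddAbove_range_norm hM) (kernel m).integrable.norm hg.norm
    refine (kernel χ).integrable.norm.mul_bdd (c := (∫ y, ‖kernel m y‖) * M)
      (hc.comp (by fun_prop : Continuous fun y => x - y)).aestronglyMeasurable
      (ae_of_all _ fun y => ?_)
    rw [← integral_mul_const]
    refine norm_integral_le_of_norm_le ((kernel m).integrable.norm.mul_const M)
      (ae_of_all _ fun z => ?_)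
    simp only [ContinuousLinearMap.mul_apply', norm_mul, norm_norm]
    gcongr
    exact hM _

/-! ### Pointwise convergence of the dyadic decomposition -/

lemma norm_toZeroAtInfty_le (f : C₀(Rn n, ℂ)) (x : Rn n) : ‖f x‖ ≤ ‖f.toBCF‖ :=
  f.toBCF.norm_coe_le_norm x

lemma dyadicBlock_eq (φ : 𝓢(Rn n, ℝ)) (k : ℤ) (f : Rn n → ℂ) :
    dyadicBlock φ k f = conv (kernel (dilate (freq k) (toComplex φ))) f := by
  rw [dyadicBlock, dyadicKernel_eq]

lemma dyadicBlock_eq_sub {φ : 𝓢(Rn n, ℝ)} {ψ : 𝓢(Rn n, ℂ)}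
    (h : ∀ ξ, (φ ξ : ℂ) = ψ ξ - ψ ((2 : ℝ) • ξ)) (f : C₀(Rn n, ℂ)) (k : ℤ) (x : Rn n) :
    dyadicBlock φ k f x = conv (kernel (dilate (freq k) ψ)) f x
      - conv (kernel (dilate (freq (k - 1)) ψ)) f x := by
  have hm : dilate (freq k) (toComplex φ) = dilate (freq k) ψ - dilate (freq (k - 1)) ψ := by
    ext ξ
    simp only [dilate_apply, toComplex_apply, h, sub_apply, freq_sub_one, mul_smul]
  have hK : kernel (dilate (freq k) ψ - dilate (freq (k - 1)) ψ)
      = kernel (dilate (freq k) ψ) - kernel (dilate (freq (k - 1)) ψ) :=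
    map_sub (FourierTransform.fourierInvCLM ℂ 𝓢(Rn n, ℂ)) _ _
  rw [dyadicBlock_eq, hm, hK, conv_sub_left _ _ (map_continuous f) (norm_toZeroAtInfty_le f)]

/-- The terms `k ≥ 0` telescope to `a - S (-1)` and the terms `k < 0` to `S (-1)`. Summability being
assumed, the limits of these partial sums suffice. -/
lemma hasSum_of_telescoping {b S : ℤ → ℂ} {a : ℂ} (hb : ∀ k, b k = S k - S (k - 1))
    (hpos : Tendsto (fun N : ℕ => S N) atTop (𝓝 a))
    (hneg : Tendsto (fun N : ℕ => S (-(N : ℤ))) atTop (𝓝 0)) (hs : Summable b) : HasSum b a := by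
  have h1 : HasSum (fun k : ℕ => b k) (a - S (-1)) := by
    have hsum : Summable fun k : ℕ => b k :=
      hs.comp_injective Nat.cast_injective
    rw [hsum.hasSum_iff_tendsto_nat, ← tendsto_add_atTop_iff_nat 1]
    refine (hpos.sub_const _).congr fun N => ?_
    have := Finset.sum_range_sub (fun k : ℕ => S ((k : ℤ) - 1)) (N + 1)
    simp only [Nat.cast_add, Nat.cast_one, add_sub_cancel_right, Nat.cast_zero, zero_sub] at this
    rw [← this]
    exact Finset.sum_congr rfl fun k _ => (hb k).symm
  have h2 : HasSum (fun k : ℕ => b (-((k : ℤ) + 1))) (S (-1)) := by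
    have hsum : Summable fun k : ℕ => b (-((k : ℤ) + 1)) :=
      hs.comp_injective (i := fun k : ℕ => -((k : ℤ) + 1)) fun a b hab => by
        simpa using hab
    rw [hsum.hasSum_iff_tendsto_nat]
    have h3 : Tendsto (fun N : ℕ => S (-1) - S (-((N + 1 : ℕ) : ℤ))) atTop (𝓝 (S (-1) - 0)) :=
      (((tendsto_add_atTop_iff_nat 1).2 hneg).const_sub _)
    rw [sub_zero] at h3
    refine h3.congr fun N => ?_
    have := Finset.sum_range_sub' (fun k : ℕ => S (-((k + 1 : ℕ) : ℤ))) N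
    simp only [zero_add, Nat.cast_one] at this
    rw [← this]
    refine Finset.sum_congr rfl fun k _ => ?_
    rw [hb]
    congr 2
  simpa using h1.of_nat_of_neg_add_one h2

lemma hasSum_dyadicBlock (hn : 1 ≤ n) {φ : 𝓢(Rn n, ℝ)} (hφ : IsDyadicGenerator φ)
    (f : C₀(Rn n, ℂ)) (x : Rn n) (hs : Summable fun k : ℤ => dyadicBlock φ k f x) :
    HasSum (fun k : ℤ => dyadicBlock φ k f x) (f x) := by
  obtain ⟨ψ, hψ0, hψ, -⟩ := hφ.exists_lowPass
  have hpos := tendsto_conv_freq ψ f x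
  rw [hψ0, one_mul] at hpos
  exact hasSum_of_telescoping (S := fun k => conv (kernel (dilate (freq k) ψ)) f x)
    (fun k => dyadicBlock_eq_sub hψ f k x) hpos (tendsto_conv_freq_neg hn ψ f x) hs

/-! ### Square-integrable band-limited functions -/

lemma lintegral_comp_smul (F : Rn n → ℝ≥0∞) {c : ℝ} (hc : c ≠ 0) :
    ∫⁻ x, F (c • x) = ENNReal.ofReal |(c ^ n)⁻¹| * ∫⁻ x, F x := by
  have h := Measure.map_addHaar_smul (volume : Measure (Rn n)) hc
  rw [finrank_euclideanSpace_fin] at h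
  have he : MeasurableEmbedding fun x : Rn n => c • x :=
    (Homeomorph.smulOfNeZero c hc).measurableEmbedding
  rw [← he.lintegral_map F, h, lintegral_smul_measure, smul_eq_mul]

lemma eLpNorm_two_eq (g : Rn n → ℂ) :
    eLpNorm g 2 volume = (∫⁻ x, ‖g x‖ₑ ^ (2 : ℝ)) ^ (1 / 2 : ℝ) := by
  rw [eLpNorm_eq_lintegral_rpow_enorm_toReal two_ne_zero ENNReal.ofNat_ne_top]
  simp

lemma eLpNorm_dilate (m : 𝓢(Rn n, ℂ)) (k : ℤ) :
    eLpNorm (dilate (freq k) m) 2 volume =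
      ENNReal.ofReal ((2 : ℝ) ^ ((k : ℝ) * (n / 2))) *
        eLpNorm (dilate (freq 0) m) 2 volume := by
  have h := lintegral_comp_smul (fun x => ‖dilate (freq 0) m x‖ₑ ^ (2 : ℝ))
    (c := (2 : ℝ) ^ (-k)) (by positivity)
  have h2 : ∀ x, dilate (freq 0) m ((2 : ℝ) ^ (-k) • x) = dilate (freq k) m x := by
    intro x
    simp only [dilate_apply, freq_val, smul_smul]
    congr 2
    simp [mul_comm]
  simp only [h2] at h
  rw [eLpNorm_two_eq, eLpNorm_two_eq, h, ENNReal.mul_rpow_of_nonneg _ _ (by norm_num),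
    abs_of_nonneg (by positivity), ENNReal.ofReal_rpow_of_nonneg (by positivity) (by norm_num)]
  congr 2
  rw [zpow_neg, inv_pow, inv_inv, ← Real.rpow_intCast, ← Real.rpow_mul_natCast zero_le_two,
    ← Real.rpow_mul zero_le_two]
  congr 1
  ring

lemma eLpNorm_kernel (m : 𝓢(Rn n, ℂ)) :
    eLpNorm (kernel m) 2 volume = eLpNorm m 2 volume := by
  have h := SchwartzMap.norm_fourier_toL2_eq (kernel m)
  rw [FourierTransform.fourier_fourierInv_eq, SchwartzMap.norm_toLp, SchwartzMap.norm_toLp] at h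
  have h1 : eLpNorm m 2 volume ≠ ⊤ := (m.eLpNorm_lt_top 2 volume).ne
  have h2 : eLpNorm (kernel m) 2 volume ≠ ⊤ := ((kernel m).eLpNorm_lt_top 2 volume).ne
  rw [← ENNReal.toReal_eq_toReal_iff' h2 h1, h]

/-- The function `y ↦ conj (K (x - y))`. -/
noncomputable def reflectConj (K : 𝓢(Rn n, ℂ)) (x : Rn n) : 𝓢(Rn n, ℂ) :=
  SchwartzMap.postcompCLM (𝕜 := ℝ) (Complex.conjCLE : ℂ →L[ℝ] ℂ)
    (SchwartzMap.compCLMOfContinuousLinearEquiv ℝ (ContinuousLinearEquiv.neg ℝ)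
      (SchwartzMap.compSubConstCLM ℝ (-x) K))

lemma reflectConj_apply (K : 𝓢(Rn n, ℂ)) (x y : Rn n) :
    reflectConj K x y = starRingEnd ℂ (K (x - y)) := by
  change starRingEnd ℂ (K (-y - -x)) = _
  rw [sub_neg_eq_add, neg_add_eq_sub]

lemma fourier_reflectConj (m : 𝓢(Rn n, ℂ)) (x t : Rn n) :
    (𝓕 (reflectConj (kernel m) x)) t =
      starRingEnd ℂ (Complex.exp (((2 * Real.pi * inner ℝ t x : ℝ) : ℂ) * Complex.I) * m t) := by
  have hm : m t = (𝓕 (kernel m)) t := by rw [FourierTransform.fourier_fourierInv_eq]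
  rw [hm, SchwartzMap.fourier_coe, SchwartzMap.fourier_coe, Real.fourier_eq', Real.fourier_eq',
    ← smul_eq_mul (a := Complex.exp _), ← integral_smul, ← integral_conj,
    ← integral_sub_left_eq_self _ _ x]
  refine integral_congr_ae (ae_of_all _ fun y => ?_)
  simp only [reflectConj_apply, smul_eq_mul, map_mul, ← Complex.exp_conj, Complex.conj_ofReal,
    Complex.conj_I, sub_sub_cancel]
  rw [← mul_assoc, ← Complex.exp_add, inner_sub_left, real_inner_comm t x]
  congr 2
  push_cast
  ring

/-- A square-integrable function reproduced by the kernel of `m` is the Fourier integral of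
an integrable function. -/
lemma exists_fourier_density {m : 𝓢(Rn n, ℂ)} {g : Rn n → ℂ} (hg : MemLp g 2 volume)
    (hrep : conv (kernel m) g = g) :
    ∃ G : Rn n → ℂ, Integrable G ∧
      ∫⁻ t, ‖G t‖ₑ ≤ eLpNorm m 2 volume * eLpNorm g 2 volume ∧
      ∀ x, g x = ∫ t, Complex.exp (((2 * Real.pi * inner ℝ t x : ℝ) : ℂ) * Complex.I) * G t := by
  set gL : Lp ℂ 2 (volume : Measure (Rn n)) := hg.toLp g
  set gF : Lp ℂ 2 (volume : Measure (Rn n)) := 𝓕 gL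
  have hbound : eLpNorm ((m : Rn n → ℂ) • (gF : Rn n → ℂ)) 1 volume
      ≤ eLpNorm m 2 volume * eLpNorm g 2 volume := by
    have h1 : eLpNorm gF 2 volume = eLpNorm g 2 volume := by
      have h2 : ‖gF‖ = ‖gL‖ := Lp.norm_fourier_eq gL
      rw [Lp.norm_def, Lp.norm_def, ENNReal.toReal_eq_toReal_iff' (Lp.memLp gF).2.ne
        (Lp.memLp gL).2.ne] at h2
      rw [h2]
      exact eLpNorm_congr_ae hg.coeFn_toLp
    rw [← h1]
    exact eLpNorm_smul_le_mul_eLpNorm (Lp.memLp gF).1 m.continuous.aestronglyMeasurable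
  -- The density is `m · 𝓕 g`, a product of two square-integrable functions and hence integrable.
  refine ⟨(m : Rn n → ℂ) • (gF : Rn n → ℂ), ?_, ?_, fun x => ?_⟩
  · rw [← memLp_one_iff_integrable]
    exact (Lp.memLp gF).smul (m.memLp 2 volume)
  · rwa [eLpNorm_one_eq_lintegral_enorm] at hbound
  -- Writing the convolution at `x` as an inner product with `reflectConj` lets Plancherel apply,
  -- and gives the formula at every `x`, not just almost everywhere.
  · have h1 : g x = ∫ y, inner ℂ (reflectConj (kernel m) x y) (g y) := by
      conv_lhs => rw [← hrep]
      rw [conv_apply, ← integral_sub_left_eq_self _ _ x]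
      refine integral_congr_ae (ae_of_all _ fun y => ?_)
      simp only [sub_sub_cancel, RCLike.inner_apply, reflectConj_apply, Complex.conj_conj]
      ring
    have h2 : inner ℂ ((reflectConj (kernel m) x).toLp 2) gL
        = ∫ y, inner ℂ (reflectConj (kernel m) x y) (g y) := by
      rw [L2.inner_def]
      refine integral_congr_ae ?_
      filter_upwards [SchwartzMap.coeFn_toLp (reflectConj (kernel m) x) 2 volume,
        hg.coeFn_toLp] with y hy hy'
      rw [hy, hy']
    rw [h1, ← h2, ← Lp.inner_fourier_eq, SchwartzMap.toLp_fourier_eq, L2.inner_def]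
    refine integral_congr_ae ?_
    filter_upwards [SchwartzMap.coeFn_toLp (𝓕 (reflectConj (kernel m) x)) 2 volume] with y hy
    rw [hy, fourier_reflectConj, RCLike.inner_apply, starRingEnd_self_apply, Pi.smul_apply',
      smul_eq_mul]
    ring

/-- Rescaling by `2π` passes to the character `e^{i(x,t)}`; the factor `(2π)^{-n}` keeps the `L_1`
norm unchanged. -/
lemma exists_represents {m : 𝓢(Rn n, ℂ)} {g : Rn n → ℂ} (hg : MemLp g 2 volume)
    (hrep : conv (kernel m) g = g) :
    ∃ h : Rn n → ℂ, Represents h g ∧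
      ∫⁻ t, ‖h t‖ₑ ≤ eLpNorm m 2 volume * eLpNorm g 2 volume := by
  obtain ⟨G, hG, hGle, hGg⟩ := exists_fourier_density hg hrep
  have hpi : (0 : ℝ) < 2 * Real.pi := by positivity
  have hint : Integrable fun t : Rn n => G ((2 * Real.pi)⁻¹ • t) := by
    simpa using hG.comp_smul (inv_ne_zero hpi.ne')
  have hscale : ∀ {F : Type} [NormedAddCommGroup F] [NormedSpace ℝ F] (H : Rn n → F),
      ∫ t, ((2 * Real.pi) ^ n)⁻¹ • H ((2 * Real.pi)⁻¹ • t) = ∫ t, H t := by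
    intro F _ _ H
    rw [integral_smul, Measure.integral_comp_smul, finrank_euclideanSpace_fin,
      abs_of_nonneg (by positivity), smul_smul, inv_pow, inv_inv,
      inv_mul_cancel₀ (by positivity), one_smul]
  have hint' : Integrable fun t : Rn n => ((2 * Real.pi) ^ n)⁻¹ • G ((2 * Real.pi)⁻¹ • t) :=
    hint.smul (((2 * Real.pi) ^ n)⁻¹ : ℝ)
  refine ⟨fun t => ((2 * Real.pi) ^ n)⁻¹ • G ((2 * Real.pi)⁻¹ • t), ⟨hint', fun x => ?_⟩, ?_⟩
  · rw [hGg, ← hscale]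
    refine integral_congr_ae (ae_of_all _ fun t => ?_)
    simp only [char, smul_mul_assoc, real_inner_smul_left]
    rw [← mul_assoc, mul_inv_cancel₀ hpi.ne', one_mul, real_inner_comm, mul_comm Complex.I]
    congr 1
    ring
  · refine le_trans (le_of_eq ?_) hGle
    rw [← ofReal_integral_norm_eq_lintegral_enorm hG,
      ← ofReal_integral_norm_eq_lintegral_enorm hint', ← hscale fun t => ‖G t‖]
    congr 2
    ext t
    rw [norm_smul, Real.norm_of_nonneg (by positivity), smul_eq_mul]

/-! ### Summation of Fourier integrals -/

lemma norm_char (x t : Rn n) : ‖char x t‖ = 1 := by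
  rw [char, mul_comm, Complex.norm_exp_ofReal_mul_I]

lemma continuous_char (x : Rn n) : Continuous (char x) := by
  unfold char
  fun_prop

lemma represents_tsum {f : Rn n → ℂ} {b : ℤ → Rn n → ℂ} {h : ℤ → Rn n → ℂ}
    (hb : ∀ k, Represents (h k) (b k)) (hfin : ∑' k, ∫⁻ t, ‖h k t‖ₑ ≠ ⊤)
    (hf : ∀ x, (Summable fun k => b k x) → HasSum (fun k => b k x) (f x)) :
    Represents (fun t => ∑' k, h k t) f := by
  have hmeas : AEStronglyMeasurable (fun t => ∑' k, h k t) volume := by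
    have hsum : ∀ᵐ t, Summable fun k => h k t := by
      have h1 : ∀ᵐ t, ∑' k, ‖h k t‖ₑ < ⊤ := by
        refine ae_lt_top' (AEMeasurable.tsum fun k => (hb k).1.1.enorm) ?_
        rwa [lintegral_tsum fun k => (hb k).1.1.enorm]
      filter_upwards [h1] with t ht
      exact Summable.of_enorm ht.ne
    refine aestronglyMeasurable_of_tendsto_ae (u := (atTop : Filter (Finset ℤ)))
      (f := fun s t => ∑ k ∈ s, h k t) (fun s => ?_) ?_
    · exact Finset.aestronglyMeasurable_fun_sum s fun k _ => (hb k).1.1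
    · filter_upwards [hsum] with t ht using ht.hasSum
  refine ⟨⟨hmeas, ?_⟩, fun x => ?_⟩
  · refine lt_of_le_of_lt (lintegral_mono fun t => enorm_tsum_le_tsum_enorm) ?_
    rw [lintegral_tsum fun k => (hb k).1.1.enorm]
    exact hfin.lt_top
  -- Each `|b k x|` is at most the `L_1` norm of `h k`, so the series converges absolutely and `hf`
  -- applies.
  · have hsummable : Summable fun k => b k x := by
      refine Summable.of_enorm (ne_top_of_le_ne_top hfin (ENNReal.tsum_le_tsum fun k => ?_))
      rw [(hb k).2 x]
      refine (enorm_integral_le_lintegral_enorm _).trans (lintegral_mono fun t => ?_)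
      rw [enorm_mul, ← ofReal_norm (char x t), norm_char, ENNReal.ofReal_one, mul_one]
    have h1 := integral_tsum (f := fun k t => h k t * char x t)
      (fun k => (hb k).1.1.mul (continuous_char x).aestronglyMeasurable) (by
        convert! hfin using 5 with k t
        rw [enorm_mul, ← ofReal_norm (char x t), norm_char, ENNReal.ofReal_one, mul_one])
    simp only [tsum_mul_right, ← (hb _).2 x] at h1
    rw [h1]
    exact (hf x hsummable).tsum_eq.symm

lemma wienerNorm_le_of_represents {g f : Rn n → ℂ} (h : Represents g f) :
    wienerNorm f ≤ ∫⁻ t, ‖g t‖ₑ := iInf₂_le g h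

/-! ### Nikolskii's inequality -/

/-- Nikolskii's inequality between `L_p` and `L_2`, `0 < p < 2`, for a bounded function
reproduced by a kernel. -/
lemma nikolskii {K : 𝓢(Rn n, ℂ)} {g : Rn n → ℂ} (hg : Continuous g) {M : ℝ}
    (hM : ∀ x, ‖g x‖ ≤ M) (hrep : conv K g = g) {p : ℝ} (hp : 0 < p) (hp2 : p < 2) :
    eLpNorm g 2 volume ≤
      eLpNorm K 2 volume ^ ((2 - p) / p) * (∫⁻ x, ‖g x‖ₑ ^ p) ^ (1 / p) := by
  set S : ℝ≥0∞ := ⨆ x, ‖g x‖ₑ with hS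
  set Q : ℝ≥0∞ := ∫⁻ x, ‖g x‖ₑ ^ p with hQ
  set κ : ℝ≥0∞ := eLpNorm K 2 volume with hκ
  have hle : ∀ x, ‖g x‖ₑ ≤ S := le_iSup fun x => ‖g x‖ₑ
  have hStop : S ≠ ⊤ := by
    refine ne_top_of_le_ne_top (ENNReal.ofReal_ne_top (r := M)) (iSup_le fun x => ?_)
    rw [← ofReal_norm]
    exact ENNReal.ofReal_le_ofReal (hM x)
  have hgm : Measurable fun x => ‖g x‖ₑ := hg.measurable.enorm
  -- Split `|g| = |g|^{1-p/2} |g|^{p/2}` in `g = K * g`, bound the first factor by the supremum, and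
  -- apply Cauchy–Schwarz to the rest.
  have hsup : S ≤ S ^ (1 - p / 2) * (κ * Q ^ (1 / 2 : ℝ)) := by
    refine iSup_le fun x => ?_
    have hx : ‖g x‖ₑ ≤ ∫⁻ y, ‖K y‖ₑ * ‖g (x - y)‖ₑ := by
      conv_lhs => rw [← hrep]
      rw [conv_apply]
      refine (enorm_integral_le_lintegral_enorm _).trans (lintegral_mono fun y => ?_)
      rw [enorm_mul]
    refine hx.trans ?_
    have hm2 : Measurable fun y => ‖g (x - y)‖ₑ := hgm.comp (measurable_id.const_sub x)
    have h1 : ∀ y, ‖K y‖ₑ * ‖g (x - y)‖ₑ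
        ≤ S ^ (1 - p / 2) * (‖K y‖ₑ * ‖g (x - y)‖ₑ ^ (p / 2)) := by
      intro y
      have h2 : ‖g (x - y)‖ₑ = ‖g (x - y)‖ₑ ^ (1 - p / 2) * ‖g (x - y)‖ₑ ^ (p / 2) := by
        rw [← ENNReal.rpow_add_of_nonneg _ _ (by linarith) (by linarith), sub_add_cancel,
          ENNReal.rpow_one]
      calc ‖K y‖ₑ * ‖g (x - y)‖ₑ
          = ‖g (x - y)‖ₑ ^ (1 - p / 2) * (‖K y‖ₑ * ‖g (x - y)‖ₑ ^ (p / 2)) := by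
            conv_lhs => rw [h2]
            ring
        _ ≤ _ := by
            gcongr
            · linarith
            · exact hle _
    have hKm : Measurable fun y => ‖K y‖ₑ := K.continuous.measurable.enorm
    refine (lintegral_mono h1).trans ?_
    have hprod : Measurable fun y => ‖K y‖ₑ * ‖g (x - y)‖ₑ ^ (p / 2) :=
      hKm.mul (hm2.pow_const _)
    rw [lintegral_const_mul _ hprod]
    gcongr
    refine (ENNReal.lintegral_mul_le_Lp_mul_Lq volume Real.HolderConjugate.two_two
      hKm.aemeasurable (hm2.pow_const (p / 2)).aemeasurable).trans ?_
    rw [hκ, eLpNorm_two_eq]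
    gcongr
    simp only [← ENNReal.rpow_mul, div_mul_cancel₀ p (two_ne_zero' ℝ)]
    rw [lintegral_sub_left_eq_self (fun y => ‖g y‖ₑ ^ p) x]
  -- Boundedness of `g` makes `S` finite, so `S^{1-p/2}` can be cancelled.
  have hS2 : S ^ (p / 2) ≤ κ * Q ^ (1 / 2 : ℝ) := by
    rcases eq_or_ne S 0 with h0 | h0
    · rw [h0, ENNReal.zero_rpow_of_pos (by linarith)]
      exact zero_le
    · have h3 : S = S ^ (1 - p / 2) * S ^ (p / 2) := by
        rw [← ENNReal.rpow_add_of_nonneg _ _ (by linarith) (by linarith), sub_add_cancel,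
          ENNReal.rpow_one]
      rw [h3] at hsup
      conv_rhs at hsup => rw [← h3]
      have h4 : S ^ (1 - p / 2) ≠ 0 := by
        simp [ENNReal.rpow_eq_zero_iff, h0, hStop]
      have h5 : S ^ (1 - p / 2) ≠ ⊤ := ENNReal.rpow_ne_top_of_nonneg (by linarith) hStop
      exact (ENNReal.mul_le_mul_iff_right h4 h5).1 hsup
  have hsq : ∫⁻ x, ‖g x‖ₑ ^ (2 : ℝ) ≤ S ^ (2 - p) * Q := by
    rw [hQ, ← lintegral_const_mul _ (hgm.pow_const _)]
    refine lintegral_mono fun x => ?_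
    calc ‖g x‖ₑ ^ (2 : ℝ) = ‖g x‖ₑ ^ (2 - p) * ‖g x‖ₑ ^ p := by
          rw [← ENNReal.rpow_add_of_nonneg _ _ (by linarith) hp.le, sub_add_cancel]
      _ ≤ _ := by
          gcongr
          exact hle x
  have hS3 : S ^ (2 - p) ≤ (κ * Q ^ (1 / 2 : ℝ)) ^ (2 * ((2 - p) / p)) := by
    have : S ^ (2 - p) = (S ^ (p / 2)) ^ (2 * ((2 - p) / p)) := by
      rw [← ENNReal.rpow_mul]
      congr 1
      field_simp
    rw [this]
    have : 0 ≤ (2 - p) / p := div_nonneg (by linarith) hp.le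
    gcongr
  have hr : 0 ≤ (2 - p) / p := div_nonneg (by linarith) hp.le
  calc eLpNorm g 2 volume = (∫⁻ x, ‖g x‖ₑ ^ (2 : ℝ)) ^ (1 / 2 : ℝ) := eLpNorm_two_eq g
    _ ≤ ((κ * Q ^ (1 / 2 : ℝ)) ^ (2 * ((2 - p) / p)) * Q) ^ (1 / 2 : ℝ) := by
        gcongr
        exact hsq.trans (by gcongr)
    _ = κ ^ ((2 - p) / p) * Q ^ (1 / p) := by
        rw [ENNReal.mul_rpow_of_nonneg _ _ (by norm_num), ← ENNReal.rpow_mul,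
          ENNReal.mul_rpow_of_nonneg _ _ (by linarith), ← ENNReal.rpow_mul, mul_assoc,
          ← ENNReal.rpow_add_of_nonneg _ _ (by linarith) (by norm_num)]
        congr 2
        · ring
        · field_simp
          ring

/-! ### Interpolation between weighted Lebesgue spaces -/

lemma recip_eq (q : ℝ≥0∞) : recip q = q.toReal⁻¹ := ENNReal.toReal_inv q

lemma one_le_ofReal_mul_ofReal {a b : ℝ} (ha : 0 ≤ a) (h : 1 ≤ a * b) :
    1 ≤ ENNReal.ofReal a * ENNReal.ofReal b := by
  rw [← ENNReal.ofReal_mul ha]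
  exact ENNReal.one_le_ofReal.2 h

lemma ofReal_rpow_one_div_rpow {a c : ℝ} (ha : 0 ≤ a) (hc : 0 < c) :
    ENNReal.ofReal (a ^ (1 / c)) ^ c = ENNReal.ofReal a := by
  rw [← ENNReal.ofReal_rpow_of_nonneg ha (by positivity), ← ENNReal.rpow_mul,
    one_div_mul_cancel hc.ne', ENNReal.rpow_one]

/-- Hölder's inequality for `L_2` between `L_q(u^{1/(1-γ)})` and `L_r(v^{1/γ})`. -/
lemma eLpNorm_two_le_weighted {q r : ℝ≥0∞} (hq : 0 < q) (hq2 : q < 2) (hr2 : 2 < r) {η : ℝ}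
    (hη : (1 - η) * recip q + η * recip r = 1 / 2) {u v : Rn n → ℝ} (hu : Measurable u)
    (hv : Measurable v) (hu1 : ∀ x, 1 ≤ u x) (huv : ∀ x, 1 ≤ u x * v x)
    {g : Rn n → ℂ} (hg : Continuous g) :
    eLpNorm g 2 volume ≤ weightedLpNorm q (weightU 2 q r u) g ^ (1 - η) *
      weightedLpNorm r (weightV 2 q r v) g ^ η := by
  have hqtop : q ≠ ⊤ := (hq2.trans_le le_top).ne
  set a := q.toReal with ha
  have ha0 : 0 < a := ENNReal.toReal_pos hq.ne' hqtop
  have ha2 : a < 2 := by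
    have := (ENNReal.toReal_lt_toReal hqtop ENNReal.ofNat_ne_top).2 hq2
    simpa using this
  have hu0 : ∀ x, 0 ≤ u x := fun x => zero_le_one.trans (hu1 x)
  have hv0 : ∀ x, 0 ≤ v x := fun x => by
    by_contra hneg
    nlinarith [huv x, hu0 x]
  have hgm : Measurable fun x => ‖g x‖ₑ := hg.measurable.enorm
  rw [recip_eq, recip_eq, ← ha] at hη
  rw [eLpNorm_two_eq]
  by_cases hr : r = ⊤
  · have hη1 : η = 1 - a / 2 := by
      rw [hr, ENNReal.toReal_top, inv_zero, mul_zero, add_zero] at hη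
      field_simp at hη
      linarith
    have hU : weightU 2 q r u = u := by
      ext x
      simp [weightU, gam, hqtop, hr, hq2]
    have hV : weightV 2 q r v = fun x => v x ^ (1 / (2 - a)) := by
      ext x
      simp [weightV, hr, ha]
    rw [hU, hV, weightedLpNorm, if_neg hqtop, weightedLpNorm, if_pos hr, ← ha]
    set T := essSup (fun x => ‖g x‖ₑ * ENNReal.ofReal (v x ^ (1 / (2 - a)))) volume
    have hprod : Measurable fun x => ‖g x‖ₑ ^ a * ENNReal.ofReal (u x) :=
      (hgm.pow_const _).mul hu.ennreal_ofReal
    have hint : ∫⁻ x, ‖g x‖ₑ ^ (2 : ℝ)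
        ≤ T ^ (2 - a) * ∫⁻ x, ‖g x‖ₑ ^ a * ENNReal.ofReal (u x) := by
      rw [← lintegral_const_mul _ hprod]
      refine lintegral_mono_ae ?_
      filter_upwards [ENNReal.ae_le_essSup
        (μ := volume) fun x => ‖g x‖ₑ * ENNReal.ofReal (v x ^ (1 / (2 - a)))] with x hx
      calc ‖g x‖ₑ ^ (2 : ℝ) = ‖g x‖ₑ ^ (2 - a) * ‖g x‖ₑ ^ a * 1 := by
            rw [mul_one, ← ENNReal.rpow_add_of_nonneg _ _ (by linarith) ha0.le, sub_add_cancel]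
        _ ≤ ‖g x‖ₑ ^ (2 - a) * ‖g x‖ₑ ^ a * (ENNReal.ofReal (u x) * ENNReal.ofReal (v x)) := by
            gcongr
            exact one_le_ofReal_mul_ofReal (hu0 x) (huv x)
        _ = (‖g x‖ₑ * ENNReal.ofReal (v x ^ (1 / (2 - a)))) ^ (2 - a)
              * (‖g x‖ₑ ^ a * ENNReal.ofReal (u x)) := by
            rw [ENNReal.mul_rpow_of_nonneg _ _ (by linarith),
              ofReal_rpow_one_div_rpow (hv0 x) (by linarith)]
            ring
        _ ≤ _ := by
            gcongr
    calc (∫⁻ x, ‖g x‖ₑ ^ (2 : ℝ)) ^ (1 / 2 : ℝ)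
        ≤ (T ^ (2 - a) * ∫⁻ x, ‖g x‖ₑ ^ a * ENNReal.ofReal (u x)) ^ (1 / 2 : ℝ) := by gcongr
      _ = _ := by
          rw [ENNReal.mul_rpow_of_nonneg _ _ (by norm_num), ← ENNReal.rpow_mul,
            ← ENNReal.rpow_mul, mul_comm, hη1]
          congr 2
          · field_simp
            ring
          · ring
  · set b := r.toReal with hb
    have hb2 : 2 < b := by
      have := (ENNReal.toReal_lt_toReal ENNReal.ofNat_ne_top hr).2 hr2
      simpa using this
    have hγ : gam 2 q r = (2 - a) / (b - a) := by
      simp [gam, hr, hq2, ha, hb]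
    have hU : weightU 2 q r u = fun x => u x ^ (1 / (1 - (2 - a) / (b - a))) := by
      ext x
      simp only [weightU, hqtop, if_false, hγ]
    have hV : weightV 2 q r v = fun x => v x ^ (1 / ((2 - a) / (b - a))) := by
      ext x
      simp only [weightV, hr, if_false, hγ]
    rw [hU, hV, weightedLpNorm, if_neg hqtop, weightedLpNorm, if_neg hr, ← ha, ← hb]
    have hba : 0 < b - a := by linarith
    set γ := (2 - a) / (b - a) with hγdef
    have hγ0 : 0 < γ := div_pos (by linarith) hba
    have hγ1 : 0 < 1 - γ := by
      rw [hγdef, sub_pos, div_lt_one hba]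
      linarith
    have hγmul : γ * (b - a) = 2 - a := div_mul_cancel₀ _ hba.ne'
    -- Here `γ` is the Hölder weight for the integrals, `2 = (1-γ)a + γb`. Taking roots to pass to
    -- quasi-norms turns it into `η = γb/2`.
    have hηγ : η = γ * b / 2 := by
      have hb0 : b ≠ 0 := by linarith
      field_simp at hη
      have h1 : η * (b - a) = γ * b / 2 * (b - a) := by
        linear_combination (-1 / 2 : ℝ) * hη - b / 2 * hγmul
      exact mul_right_cancel₀ hba.ne' h1
    have hη1γ : 1 - η = (1 - γ) * a / 2 := by
      rw [hηγ]
      linear_combination (-1 / 2 : ℝ) * hγmul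
    have hint : ∫⁻ x, ‖g x‖ₑ ^ (2 : ℝ)
        ≤ (∫⁻ x, ‖g x‖ₑ ^ a * ENNReal.ofReal (u x ^ (1 / (1 - γ)))) ^ (1 - γ)
          * (∫⁻ x, ‖g x‖ₑ ^ b * ENNReal.ofReal (v x ^ (1 / γ))) ^ γ := by
      refine le_trans (lintegral_mono fun x => ?_) (ENNReal.lintegral_mul_norm_pow_le
        (((hgm.pow_const _).mul (hu.pow_const _).ennreal_ofReal).aemeasurable)
        (((hgm.pow_const _).mul (hv.pow_const _).ennreal_ofReal).aemeasurable)
        hγ1.le hγ0.le (sub_add_cancel 1 γ))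
      calc ‖g x‖ₑ ^ (2 : ℝ) = ‖g x‖ₑ ^ (a * (1 - γ)) * ‖g x‖ₑ ^ (b * γ) * 1 := by
            rw [mul_one, ← ENNReal.rpow_add_of_nonneg _ _ (by positivity) (by positivity)]
            congr 1
            linear_combination -hγmul
        _ ≤ ‖g x‖ₑ ^ (a * (1 - γ)) * ‖g x‖ₑ ^ (b * γ)
              * (ENNReal.ofReal (u x) * ENNReal.ofReal (v x)) := by
            gcongr
            exact one_le_ofReal_mul_ofReal (hu0 x) (huv x)
        _ = _ := by
            simp only [Pi.mul_apply]
            rw [ENNReal.mul_rpow_of_nonneg _ _ hγ1.le, ENNReal.mul_rpow_of_nonneg _ _ hγ0.le,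
              ofReal_rpow_one_div_rpow (hv0 x) hγ0, ofReal_rpow_one_div_rpow (hu0 x) hγ1,
              ← ENNReal.rpow_mul, ← ENNReal.rpow_mul]
            ring
    refine (ENNReal.rpow_le_rpow hint (by norm_num)).trans (le_of_eq ?_)
    rw [ENNReal.mul_rpow_of_nonneg _ _ (by norm_num), ← ENNReal.rpow_mul, ← ENNReal.rpow_mul,
      ← ENNReal.rpow_mul, ← ENNReal.rpow_mul, hη1γ, hηγ]
    congr 2
    · field_simp
    · field_simp

lemma gam_swap {q r : ℝ≥0∞} (hr2 : r < 2) (hq2 : 2 < q) : gam 2 r q = 1 - gam 2 q r := by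
  have hrtop : r ≠ ⊤ := (hr2.trans_le le_top).ne
  by_cases hq : q = ⊤
  · simp [gam, hq, hr2]
  · have h : r.toReal < q.toReal := (ENNReal.toReal_lt_toReal hrtop hq).2 (hr2.trans hq2)
    have h' : q.toReal - r.toReal ≠ 0 := by linarith
    simp only [gam, ENNReal.ofReal_ofNat, hr2, not_lt.2 hq2.le, hq, if_true, if_false]
    field_simp
    ring

lemma weightU_swap {q r : ℝ≥0∞} (hr2 : r < 2) (hq2 : 2 < q) (v : Rn n → ℝ) :
    weightU 2 r q v = weightV 2 q r v := by
  have hrtop : r ≠ ⊤ := (hr2.trans_le le_top).ne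
  ext x
  simp only [weightU, weightV, hrtop, if_false, gam_swap hr2 hq2, sub_sub_cancel]

lemma weightV_swap {q r : ℝ≥0∞} (hr2 : r < 2) (hq2 : 2 < q) (u : Rn n → ℝ) :
    weightV 2 r q u = weightU 2 q r u := by
  ext x
  simp only [weightU, weightV, gam_swap hr2 hq2]

lemma one_le_weightU {q r : ℝ≥0∞} (hq2 : q < 2) (hr2 : 2 < r) {u : Rn n → ℝ}
    (hu1 : ∀ x, 1 ≤ u x) (x : Rn n) : 1 ≤ weightU 2 q r u x := by
  have hqtop : q ≠ ⊤ := (hq2.trans_le le_top).ne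
  rw [weightU, if_neg hqtop]
  refine Real.one_le_rpow (hu1 x) (one_div_nonneg.2 ?_)
  by_cases hr : r = ⊤
  · simp [gam, hq2, hr]
  · have h1 : q.toReal < 2 := by
      have := (ENNReal.toReal_lt_toReal hqtop ENNReal.ofNat_ne_top).2 hq2
      simpa using this
    have h2 : 2 < r.toReal := by
      have := (ENNReal.toReal_lt_toReal ENNReal.ofNat_ne_top hr).2 hr2
      simpa using this
    simp only [gam, ENNReal.ofReal_ofNat, hq2, hr, if_true, if_false]
    rw [sub_nonneg, div_le_one (by linarith)]
    linarith

/-! ### Sums controlled by two geometric progressions -/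

lemma summable_two_rpow_neg_abs {ε : ℝ} (hε : 0 < ε) :
    Summable fun j : ℤ => (2 : ℝ) ^ (-(ε * |(j : ℝ)|)) := by
  have h : Summable fun k : ℕ => (2 : ℝ) ^ (-(ε * (k : ℝ))) := by
    have h1 : ∀ k : ℕ, (2 : ℝ) ^ (-(ε * (k : ℝ))) = ((2 : ℝ) ^ (-ε)) ^ k := fun k => by
      rw [← Real.rpow_mul_natCast zero_le_two, neg_mul]
    simp only [h1]
    exact summable_geometric_of_lt_one (by positivity)
      (Real.rpow_lt_one_of_one_lt_of_neg one_lt_two (by linarith))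
  refine Summable.of_nat_of_neg ?_ ?_
  · simpa using h
  · simpa using h

/-- The two exponentials cross at `t = m`, with common value `x^{β/(α+β)} y^{α/(α+β)}`; away from
`m` the smaller one decays at rate at least `min α β`. -/
lemma two_sided_le {α β x y m : ℝ} (hα : 0 < α) (hβ : 0 < β) (hx : 0 < x) (hy : 0 < y)
    (hm : m = Real.logb 2 (y / x) / (α + β)) (t : ℝ) :
    min (x * 2 ^ (t * α)) (y * 2 ^ (-(t * β))) ≤
      x ^ (β / (α + β)) * y ^ (α / (α + β)) * 2 ^ (-(min α β * |t - m|)) := by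
  have hαβ : 0 < α + β := by linarith
  have hxy : (2 : ℝ) ^ (m * (α + β)) = y / x := by
    rw [hm, div_mul_cancel₀ _ hαβ.ne']
    exact Real.rpow_logb two_pos (by norm_num) (by positivity)
  have h2m : ∀ c : ℝ, (2 : ℝ) ^ (m * c) = (y / x) ^ (c / (α + β)) := fun c => by
    rw [← hxy, ← Real.rpow_mul zero_le_two]
    congr 1
    field_simp
  have hz1 : x ^ (β / (α + β)) * y ^ (α / (α + β)) = x * 2 ^ (m * α) := by
    rw [h2m, Real.div_rpow hy.le hx.le]
    have : β / (α + β) = 1 - α / (α + β) := by field_simp; ring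
    rw [this, Real.rpow_sub hx, Real.rpow_one]
    ring
  have hz2 : x ^ (β / (α + β)) * y ^ (α / (α + β)) = y * 2 ^ (-(m * β)) := by
    rw [Real.rpow_neg zero_le_two, h2m, Real.div_rpow hy.le hx.le]
    have : α / (α + β) = 1 - β / (α + β) := by field_simp; ring
    rw [this, Real.rpow_sub hy, Real.rpow_one]
    field_simp
  rcases le_total t m with h | h
  · refine (min_le_left _ _).trans ?_
    rw [hz1, mul_assoc, ← Real.rpow_add two_pos]
    gcongr
    · exact one_le_two
    · rw [abs_of_nonpos (by linarith)]
      nlinarith [min_le_left α β]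
  · refine (min_le_right _ _).trans ?_
    rw [hz2, mul_assoc, ← Real.rpow_add two_pos]
    gcongr
    · exact one_le_two
    · rw [abs_of_nonneg (by linarith)]
      nlinarith [min_le_right α β]

lemma exists_tsum_le {α β : ℝ} (hα : 0 < α) (hβ : 0 < β) :
    ∃ D : ℝ≥0, ∀ (c : ℤ → ℝ≥0∞) (X Y : ℝ≥0∞), X ≠ ⊤ → Y ≠ ⊤ →
      (∀ k : ℤ, c k ≤ X * ENNReal.ofReal (2 ^ ((k : ℝ) * α))) →
      (∀ k : ℤ, c k ≤ Y * ENNReal.ofReal (2 ^ (-((k : ℝ) * β)))) →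
      ∑' k, c k ≤ D * (X ^ (β / (α + β)) * Y ^ (α / (α + β))) := by
  have hε : 0 < min α β := lt_min hα hβ
  set ε := min α β with hεdef
  have hs := summable_two_rpow_neg_abs hε
  refine ⟨Real.toNNReal (2 ^ ε * ∑' j : ℤ, (2 : ℝ) ^ (-(ε * |(j : ℝ)|))), ?_⟩
  intro c X Y hX hY h1 h2
  -- A crossing point exists only for positive `X` and `Y`; otherwise every term is zero.
  rcases eq_or_ne X 0 with hX0 | hX0
  · have : ∀ k, c k = 0 := fun k => by simpa [hX0] using h1 k
    simp [this]
  rcases eq_or_ne Y 0 with hY0 | hY0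
  · have : ∀ k, c k = 0 := fun k => by simpa [hY0] using h2 k
    simp [this]
  obtain ⟨x, hx, rfl⟩ : ∃ x : ℝ, 0 < x ∧ X = ENNReal.ofReal x :=
    ⟨X.toReal, ENNReal.toReal_pos hX0 hX, (ENNReal.ofReal_toReal hX).symm⟩
  obtain ⟨y, hy, rfl⟩ : ∃ y : ℝ, 0 < y ∧ Y = ENNReal.ofReal y :=
    ⟨Y.toReal, ENNReal.toReal_pos hY0 hY, (ENNReal.ofReal_toReal hY).symm⟩
  set m := Real.logb 2 (y / x) / (α + β) with hm
  set z := x ^ (β / (α + β)) * y ^ (α / (α + β)) with hz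
  have hz0 : 0 ≤ z := by positivity
  -- Replacing `m` by its integer part costs a factor `2^ε`. A shift of the index then makes the sum
  -- independent of `m`.
  have hc : ∀ k : ℤ, c k ≤
      ENNReal.ofReal (z * 2 ^ ε * 2 ^ (-(ε * |((k - ⌊m⌋ : ℤ) : ℝ)|))) := by
    intro k
    refine (le_min (h1 k) (h2 k)).trans ?_
    rw [← ENNReal.ofReal_mul hx.le, ← ENNReal.ofReal_mul hy.le, ← ENNReal.ofReal_min]
    refine ENNReal.ofReal_le_ofReal ((two_sided_le hα hβ hx hy hm k).trans ?_)
    rw [← hz, mul_assoc z, ← Real.rpow_add two_pos]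
    gcongr
    · exact one_le_two
    · have h3 : |((k - ⌊m⌋ : ℤ) : ℝ)| ≤ |(k : ℝ) - m| + 1 := by
        have h4 : ((k - ⌊m⌋ : ℤ) : ℝ) = ((k : ℝ) - m) + Int.fract m := by
          rw [Int.fract]
          push_cast
          ring
        rw [h4]
        refine (abs_add_le _ _).trans ?_
        gcongr
        rw [abs_of_nonneg (Int.fract_nonneg m)]
        exact (Int.fract_lt_one m).le
      nlinarith
  calc ∑' k, c k
      ≤ ∑' k : ℤ, ENNReal.ofReal (z * 2 ^ ε * 2 ^ (-(ε * |((k - ⌊m⌋ : ℤ) : ℝ)|))) :=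
        ENNReal.tsum_le_tsum hc
    _ = ∑' j : ℤ, ENNReal.ofReal (z * 2 ^ ε * 2 ^ (-(ε * |(j : ℝ)|))) :=
        (Equiv.subRight ⌊m⌋).tsum_eq
          fun j : ℤ => ENNReal.ofReal (z * 2 ^ ε * 2 ^ (-(ε * |(j : ℝ)|)))
    _ = ENNReal.ofReal (∑' j : ℤ, z * 2 ^ ε * 2 ^ (-(ε * |(j : ℝ)|))) :=
        (ENNReal.ofReal_tsum_of_nonneg (fun j => by positivity) (hs.mul_left _)).symm
    _ = ENNReal.ofReal ((2 ^ ε * ∑' j : ℤ, (2 : ℝ) ^ (-(ε * |(j : ℝ)|))) * z) := by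
        rw [tsum_mul_left]
        congr 1
        ring
    _ = _ := by
        rw [ENNReal.ofReal_mul (mul_nonneg (by positivity) (tsum_nonneg fun j => by positivity)),
          hz, ENNReal.ofReal_mul (p := x ^ (β / (α + β))) (by positivity),
          ENNReal.ofReal_rpow_of_pos hx, ENNReal.ofReal_rpow_of_pos hy]
        rfl

/-- A sum dominated by two geometric progressions with exponents of opposite signs. -/
lemma exists_tsum_le_of_opposite {e₁ e₂ : ℝ} (he : (0 < e₁ ∧ e₂ < 0) ∨ (e₁ < 0 ∧ 0 < e₂)) :
    ∃ D : ℝ≥0, ∀ (c : ℤ → ℝ≥0∞) (X Y : ℝ≥0∞), X ≠ ⊤ → Y ≠ ⊤ →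
      (∀ k : ℤ, c k ≤ X * ENNReal.ofReal (2 ^ ((k : ℝ) * e₁))) →
      (∀ k : ℤ, c k ≤ Y * ENNReal.ofReal (2 ^ ((k : ℝ) * e₂))) →
      ∑' k, c k ≤ D * (X ^ (e₂ / (e₂ - e₁)) * Y ^ (e₁ / (e₁ - e₂))) := by
  rcases he with ⟨h1, h2⟩ | ⟨h1, h2⟩
  · obtain ⟨D, hD⟩ := exists_tsum_le h1 (neg_pos.2 h2)
    refine ⟨D, fun c X Y hX hY hcX hcY => ?_⟩
    have := hD c X Y hX hY hcX (by simpa using hcY)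
    rwa [← sub_eq_add_neg, ← neg_sub e₂ e₁, neg_div_neg_eq, neg_sub] at this
  · obtain ⟨D, hD⟩ := exists_tsum_le h2 (neg_pos.2 h1)
    refine ⟨D, fun c X Y hX hY hcX hcY => ?_⟩
    have := hD c Y X hY hX hcY (by simpa using hcX)
    rwa [← sub_eq_add_neg, ← neg_sub e₁ e₂, neg_div_neg_eq, neg_sub, mul_comm (_ ^ _)] at this

/-! ### Estimates for the dyadic blocks -/

lemma continuous_dyadicBlock (φ : 𝓢(Rn n, ℝ)) (k : ℤ) (f : C₀(Rn n, ℂ)) :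
    Continuous (dyadicBlock φ k f) := by
  rw [dyadicBlock_eq]
  exact continuous_conv_schwartz _ (map_continuous f) (norm_toZeroAtInfty_le f)

lemma exists_norm_dyadicBlock_le (φ : 𝓢(Rn n, ℝ)) (k : ℤ) (f : C₀(Rn n, ℂ)) :
    ∃ M, ∀ x, ‖dyadicBlock φ k f x‖ ≤ M := by
  rw [dyadicBlock_eq]
  exact ⟨_, norm_conv_schwartz_le _ (norm_toZeroAtInfty_le f)⟩

/-- The dyadic blocks are reproduced by the dilations of a single multiplier. -/
lemma exists_reproducing {φ : 𝓢(Rn n, ℝ)} (hφ : IsDyadicGenerator φ) :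
    ∃ χ : 𝓢(Rn n, ℂ), ∀ (f : C₀(Rn n, ℂ)) (k : ℤ),
      conv (kernel (dilate (freq k) χ)) (dyadicBlock φ k f) = dyadicBlock φ k f := by
  obtain ⟨ψ, -, -, hψ⟩ := hφ.exists_lowPass
  refine ⟨dilate (Units.mk0 (1 / 2 : ℝ) (by norm_num)) ψ, fun f k => ?_⟩
  rw [dyadicBlock_eq]
  exact conv_kernel_conv_kernel (fun ξ => hψ ((freq k : ℝ) • ξ)) (map_continuous f)
    (norm_toZeroAtInfty_le f)

/-- The homogeneous Besov space `B^{n/2}_{2,1}` is contained in the Wiener algebra. -/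
lemma exists_wienerNorm_le_tsum (hn : 1 ≤ n) {φ : 𝓢(Rn n, ℝ)} (hφ : IsDyadicGenerator φ) :
    ∃ C : ℝ≥0, ∀ f : C₀(Rn n, ℂ),
      ∑' k : ℤ, ENNReal.ofReal (2 ^ ((k : ℝ) * (n / 2))) * eLpNorm (dyadicBlock φ k f) 2 volume ≠ ⊤ →
      MemWiener f ∧ wienerNorm f ≤ C * ∑' k : ℤ, ENNReal.ofReal (2 ^ ((k : ℝ) * (n / 2))) *
        eLpNorm (dyadicBlock φ k f) 2 volume := by
  obtain ⟨χ, hχ⟩ := exists_reproducing hφ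
  have hκ : eLpNorm (dilate (freq 0) χ) 2 volume ≠ ⊤ :=
    ((dilate (freq 0) χ).eLpNorm_lt_top 2 volume).ne
  refine ⟨(eLpNorm (dilate (freq 0) χ) 2 volume).toNNReal, fun f hfin => ?_⟩
  have hL2 : ∀ k, MemLp (dyadicBlock φ k f) 2 volume := by
    intro k
    refine ⟨(continuous_dyadicBlock φ k f).aestronglyMeasurable, ?_⟩
    have h1 := ENNReal.ne_top_of_tsum_ne_top hfin k
    refine lt_top_iff_ne_top.2 fun htop => h1 ?_
    rw [htop, ENNReal.mul_top]
    exact (ENNReal.ofReal_pos.2 (by positivity)).ne'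
  choose h hrep hle using fun k => exists_represents (hL2 k) (hχ f k)
  have hsum : ∑' k, ∫⁻ t, ‖h k t‖ₑ ≤ (eLpNorm (dilate (freq 0) χ) 2 volume).toNNReal *
      ∑' k : ℤ, ENNReal.ofReal (2 ^ ((k : ℝ) * (n / 2))) *
        eLpNorm (dyadicBlock φ k f) 2 volume := by
    rw [← ENNReal.tsum_mul_left, ENNReal.coe_toNNReal hκ]
    refine ENNReal.tsum_le_tsum fun k => (hle k).trans (le_of_eq ?_)
    rw [eLpNorm_dilate]
    ring
  have hR := represents_tsum hrep
    (ne_top_of_le_ne_top (ENNReal.mul_ne_top ENNReal.coe_ne_top hfin) hsum)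
    (fun x => hasSum_dyadicBlock hn hφ f x)
  refine ⟨⟨_, hR⟩, (wienerNorm_le_of_represents hR).trans (le_trans ?_ hsum)⟩
  rw [← lintegral_tsum fun k => (hrep k).1.1.enorm]
  exact lintegral_mono fun t => enorm_tsum_le_tsum_enorm

/-- In Nikolskii's inequality the kernel has `L_2` norm proportional to `2^{kn/2}`, raised to the
power `(2-q)/q`; together with the factor `2^{kn/2}` this gives `2^{kn/q}`. The weight enters only
through `w ≥ 1`. -/
lemma exists_bernstein {φ : 𝓢(Rn n, ℝ)} (hφ : IsDyadicGenerator φ) {q : ℝ≥0∞} (hq : 0 < q)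
    (hq2 : q < 2) :
    ∃ C : ℝ≥0, ∀ (w : Rn n → ℝ), (∀ x, 1 ≤ w x) → ∀ (f : C₀(Rn n, ℂ)) (k : ℤ),
      ENNReal.ofReal (2 ^ ((k : ℝ) * (n / 2))) * eLpNorm (dyadicBlock φ k f) 2 volume ≤
        C * (ENNReal.ofReal (2 ^ ((k : ℝ) * (n * recip q))) *
          weightedLpNorm q w (dyadicBlock φ k f)) := by
  obtain ⟨χ, hχ⟩ := exists_reproducing hφ
  have hqtop : q ≠ ⊤ := (hq2.trans_le le_top).ne
  set p := q.toReal with hp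
  have hp0 : 0 < p := ENNReal.toReal_pos hq.ne' hqtop
  have hp2 : p < 2 := by
    have := (ENNReal.toReal_lt_toReal hqtop ENNReal.ofNat_ne_top).2 hq2
    simpa using this
  have hκ : eLpNorm (dilate (freq 0) χ) 2 volume ^ ((2 - p) / p) ≠ ⊤ :=
    ENNReal.rpow_ne_top_of_nonneg (div_nonneg (by linarith) hp0.le)
      ((dilate (freq 0) χ).eLpNorm_lt_top 2 volume).ne
  refine ⟨(eLpNorm (dilate (freq 0) χ) 2 volume ^ ((2 - p) / p)).toNNReal, fun w hw f k => ?_⟩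
  rw [ENNReal.coe_toNNReal hκ]
  obtain ⟨M, hM⟩ := exists_norm_dyadicBlock_le φ k f
  have h1 := nikolskii (continuous_dyadicBlock φ k f) hM (hχ f k) hp0 hp2
  rw [eLpNorm_kernel, eLpNorm_dilate, ENNReal.mul_rpow_of_nonneg _ _
    (div_nonneg (by linarith) hp0.le), ENNReal.ofReal_rpow_of_pos (by positivity),
    ← Real.rpow_mul zero_le_two] at h1
  have h2 : (∫⁻ x, ‖dyadicBlock φ k f x‖ₑ ^ p) ^ (1 / p)
      ≤ weightedLpNorm q w (dyadicBlock φ k f) := by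
    rw [weightedLpNorm, if_neg hqtop, ← hp]
    gcongr with x
    exact le_mul_of_one_le_right' (ENNReal.one_le_ofReal.2 (hw x))
  have h3 : (2 : ℝ) ^ ((k : ℝ) * (n * recip q))
      = 2 ^ ((k : ℝ) * (n / 2)) * 2 ^ ((k : ℝ) * (n / 2) * ((2 - p) / p)) := by
    rw [← Real.rpow_add two_pos, recip_eq, ← hp]
    congr 1
    field_simp
    ring
  calc ENNReal.ofReal (2 ^ ((k : ℝ) * (n / 2))) * eLpNorm (dyadicBlock φ k f) 2 volume
      ≤ ENNReal.ofReal (2 ^ ((k : ℝ) * (n / 2))) *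
        (ENNReal.ofReal (2 ^ ((k : ℝ) * (n / 2) * ((2 - p) / p))) *
          eLpNorm (dilate (freq 0) χ) 2 volume ^ ((2 - p) / p) *
          weightedLpNorm q w (dyadicBlock φ k f)) := by
        gcongr
        exact h1.trans (by gcongr)
    _ = _ := by
        rw [h3, ENNReal.ofReal_mul (by positivity)]
        ring

lemma weightedLpNorm_block_le (φ : 𝓢(Rn n, ℝ)) (p : ℝ≥0∞) (s : ℝ) (w : Rn n → ℝ)
    (f : Rn n → ℂ) (k : ℤ) :
    weightedLpNorm p w (dyadicBlock φ k f) ≤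
      ENNReal.ofReal (2 ^ (-(s * (k : ℝ)))) * besovNorm φ p s w f := by
  have h := le_iSup (fun k : ℤ => ENNReal.ofReal ((2 : ℝ) ^ (s * (k : ℝ))) *
    weightedLpNorm p w (dyadicBlock φ k f)) k
  calc weightedLpNorm p w (dyadicBlock φ k f)
      = ENNReal.ofReal (2 ^ (-(s * (k : ℝ)))) * (ENNReal.ofReal ((2 : ℝ) ^ (s * (k : ℝ))) *
          weightedLpNorm p w (dyadicBlock φ k f)) := by
        rw [← mul_assoc, ← ENNReal.ofReal_mul (by positivity), ← Real.rpow_add two_pos,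
          neg_add_cancel, Real.rpow_zero, ENNReal.ofReal_one, one_mul]
    _ ≤ _ := by gcongr; exact h

/-! ### The interpolation theorem -/

/-- The embedding into the Wiener algebra for `q < 2 < r`, with the smoothness parameters `σ`
and `s` in arbitrary order. -/
theorem exists_wienerNorm_le (hn : 1 ≤ n) {φ : 𝓢(Rn n, ℝ)} (hφ : IsDyadicGenerator φ)
    {q r : ℝ≥0∞} (hq : 0 < q) (hq2 : q < 2) (hr2 : 2 < r) {σ s η : ℝ} (hη0 : 0 < η) (hη1 : η < 1)
    (hη : (1 - η) * recip q + η * recip r = 1 / 2)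
    (hexp : (0 < n * recip q - σ ∧ (n : ℝ) / 2 - ((1 - η) * σ + η * s) < 0) ∨
      (n * recip q - σ < 0 ∧ 0 < (n : ℝ) / 2 - ((1 - η) * σ + η * s)))
    {u v : Rn n → ℝ} (hu : Measurable u) (hv : Measurable v)
    (hu1 : ∀ x, 1 ≤ u x) (huv : ∀ x, 1 ≤ u x * v x) :
    ∃ C : ℝ≥0, ∀ f : C₀(Rn n, ℂ),
      MemBesov φ q σ (weightU 2 q r u) f → MemBesov φ r s (weightV 2 q r v) f →
      MemWiener f ∧ wienerNorm f ≤ C * besovNorm φ q σ (weightU 2 q r u) f ^ (1 - delta n q r σ s)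
        * besovNorm φ r s (weightV 2 q r v) f ^ delta n q r σ s := by
  set e₁ := n * recip q - σ with he₁
  set e₂ := (n : ℝ) / 2 - ((1 - η) * σ + η * s) with he₂
  obtain ⟨C₀, hC₀⟩ := exists_wienerNorm_le_tsum hn hφ
  obtain ⟨C₁, hC₁⟩ := exists_bernstein hφ hq hq2
  obtain ⟨D, hD⟩ := exists_tsum_le_of_opposite hexp
  set lam := e₂ / (e₂ - e₁) with hlam
  set mu := e₁ / (e₁ - e₂) with hmu
  have hne : e₁ - e₂ ≠ 0 := by rcases hexp with h | h <;> [linarith [h.1, h.2]; linarith [h.1, h.2]]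
  have hlam_mu : lam = 1 - mu := by
    rw [hlam, hmu, ← neg_sub e₁ e₂]
    field_simp
    ring
  have hlam0 : 0 < lam := by
    rcases hexp with h | h
    · exact div_pos_of_neg_of_neg h.2 (by linarith)
    · exact div_pos h.2 (by linarith)
  have hmu0 : 0 < mu := by
    rcases hexp with h | h
    · exact div_pos h.1 (by linarith)
    · exact div_pos_of_neg_of_neg h.1 (by linarith)
  -- The denominator of `δ` equals `(e₁ - e₂)/η`, which is nonzero because `e₁` and `e₂` have
  -- opposite signs.
  have hδ : delta n q r σ s = η * mu := by
    have h1 : e₁ - e₂ = η * (s - σ + n * (recip q - recip r)) := by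
      rw [he₁, he₂]
      linear_combination (n : ℝ) * hη
    have h2 : s - σ + n * (recip q - recip r) ≠ 0 := by
      intro h0
      rw [h0, mul_zero] at h1
      exact hne h1
    rw [delta, hmu, h1, ← he₁]
    field_simp
  refine ⟨C₀ * (D * C₁ ^ lam), fun f hA hB => ?_⟩
  set A := besovNorm φ q σ (weightU 2 q r u) f with hAdef
  set B := besovNorm φ r s (weightV 2 q r v) f with hBdef
  have hAtop : A ≠ ⊤ := hA.ne
  have hBtop : B ≠ ⊤ := hB.ne
  have hX : ∀ k : ℤ, ENNReal.ofReal (2 ^ ((k : ℝ) * (n / 2))) *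
      eLpNorm (dyadicBlock φ k f) 2 volume ≤ C₁ * A * ENNReal.ofReal (2 ^ ((k : ℝ) * e₁)) := by
    intro k
    refine (hC₁ _ (one_le_weightU hq2 hr2 hu1) f k).trans ?_
    calc (C₁ : ℝ≥0∞) * (ENNReal.ofReal (2 ^ ((k : ℝ) * (n * recip q))) *
          weightedLpNorm q (weightU 2 q r u) (dyadicBlock φ k f))
        ≤ C₁ * (ENNReal.ofReal (2 ^ ((k : ℝ) * (n * recip q))) *
          (ENNReal.ofReal (2 ^ (-(σ * (k : ℝ)))) * A)) := by
          gcongr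
          exact weightedLpNorm_block_le _ _ _ _ _ _
      _ = _ := by
          have : (2 : ℝ) ^ ((k : ℝ) * e₁)
              = 2 ^ ((k : ℝ) * (n * recip q)) * 2 ^ (-(σ * (k : ℝ))) := by
            rw [← Real.rpow_add two_pos, he₁]
            congr 1
            ring
          rw [this, ENNReal.ofReal_mul (by positivity)]
          ring
  have hY : ∀ k : ℤ, ENNReal.ofReal (2 ^ ((k : ℝ) * (n / 2))) *
      eLpNorm (dyadicBlock φ k f) 2 volume
        ≤ A ^ (1 - η) * B ^ η * ENNReal.ofReal (2 ^ ((k : ℝ) * e₂)) := by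
    intro k
    have h1 := eLpNorm_two_le_weighted hq hq2 hr2 hη hu hv hu1 huv (continuous_dyadicBlock φ k f)
    have hη1' : 0 < 1 - η := by linarith
    calc ENNReal.ofReal (2 ^ ((k : ℝ) * (n / 2))) * eLpNorm (dyadicBlock φ k f) 2 volume
        ≤ ENNReal.ofReal (2 ^ ((k : ℝ) * (n / 2))) *
          ((ENNReal.ofReal (2 ^ (-(σ * (k : ℝ)))) * A) ^ (1 - η) *
            (ENNReal.ofReal (2 ^ (-(s * (k : ℝ)))) * B) ^ η) := by
          gcongr
          refine h1.trans ?_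
          gcongr
          · exact weightedLpNorm_block_le _ _ _ _ _ _
          · exact weightedLpNorm_block_le _ _ _ _ _ _
      _ = _ := by
          have : (2 : ℝ) ^ ((k : ℝ) * e₂) = 2 ^ ((k : ℝ) * (n / 2)) *
              (2 ^ (-(σ * (k : ℝ)) * (1 - η)) * 2 ^ (-(s * (k : ℝ)) * η)) := by
            rw [← Real.rpow_add two_pos, ← Real.rpow_add two_pos, he₂]
            congr 1
            ring
          rw [this, ENNReal.ofReal_mul (by positivity), ENNReal.ofReal_mul (by positivity),
            ENNReal.mul_rpow_of_nonneg _ _ hη1'.le, ENNReal.mul_rpow_of_nonneg _ _ hη0.le,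
            ENNReal.ofReal_rpow_of_pos (by positivity), ENNReal.ofReal_rpow_of_pos (by positivity),
            ← Real.rpow_mul zero_le_two, ← Real.rpow_mul zero_le_two]
          ring
  have hXtop : (C₁ : ℝ≥0∞) * A ≠ ⊤ := ENNReal.mul_ne_top ENNReal.coe_ne_top hAtop
  have hYtop : A ^ (1 - η) * B ^ η ≠ ⊤ :=
    ENNReal.mul_ne_top (ENNReal.rpow_ne_top_of_nonneg (by linarith) hAtop)
      (ENNReal.rpow_ne_top_of_nonneg hη0.le hBtop)
  have hS := hD _ _ _ hXtop hYtop hX hY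
  have hfin : ∑' k : ℤ, ENNReal.ofReal (2 ^ ((k : ℝ) * (n / 2))) *
      eLpNorm (dyadicBlock φ k f) 2 volume ≠ ⊤ :=
    ne_top_of_le_ne_top (ENNReal.mul_ne_top ENNReal.coe_ne_top (ENNReal.mul_ne_top
      (ENNReal.rpow_ne_top_of_nonneg hlam0.le hXtop)
      (ENNReal.rpow_ne_top_of_nonneg hmu0.le hYtop))) hS
  obtain ⟨hmem, hnorm⟩ := hC₀ f hfin
  refine ⟨hmem, hnorm.trans ((mul_le_mul_right hS _).trans (le_of_eq ?_))⟩
  -- `A` enters through both bounds: with power `lam` from Nikolskii and `(1-η) mu` from Hölder.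
  have hpow : A ^ (1 - delta n q r σ s) = A ^ lam * A ^ ((1 - η) * mu) := by
    rw [← ENNReal.rpow_add_of_nonneg _ _ hlam0.le (mul_nonneg (by linarith) hmu0.le), hδ, hlam_mu]
    congr 1
    ring
  rw [hpow, hδ, ENNReal.mul_rpow_of_nonneg _ _ hlam0.le, ENNReal.mul_rpow_of_nonneg _ _ hmu0.le,
    ← ENNReal.rpow_mul, ← ENNReal.rpow_mul]
  push_cast
  rw [ENNReal.coe_rpow_of_nonneg _ hlam0.le]
  ring

lemma half_lt_recip {q : ℝ≥0∞} (hq : 0 < q) (hq2 : q < 2) : 1 / 2 < recip q := by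
  have hqtop : q ≠ ⊤ := (hq2.trans_le le_top).ne
  have h2 := (ENNReal.toReal_lt_toReal hqtop ENNReal.ofNat_ne_top).2 hq2
  rw [ENNReal.toReal_ofNat] at h2
  rw [recip_eq, one_div]
  exact inv_strictAnti₀ (ENNReal.toReal_pos hq.ne' hqtop) h2

lemma recip_lt_half {r : ℝ≥0∞} (hr2 : 2 < r) : recip r < 1 / 2 := by
  rw [recip_eq, one_div]
  by_cases hr : r = ⊤
  · simp [hr]
  · have h2 := (ENNReal.toReal_lt_toReal ENNReal.ofNat_ne_top hr).2 hr2
    rw [ENNReal.toReal_ofNat] at h2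
    exact inv_strictAnti₀ two_pos h2

lemma exists_interpolation_parameter {q r : ℝ≥0∞} (hq : 0 < q) (hq2 : q < 2) (hr2 : 2 < r) :
    ∃ η : ℝ, 0 < η ∧ η < 1 ∧ (1 - η) * recip q + η * recip r = 1 / 2 := by
  have h1 := half_lt_recip hq hq2
  have h2 := recip_lt_half hr2
  have h3 : 0 < recip q - recip r := by linarith
  refine ⟨(recip q - 1 / 2) / (recip q - recip r), div_pos (by linarith) h3,
    (div_lt_one h3).2 (by linarith), ?_⟩
  field_simp
  ring

lemma delta_swap {q r : ℝ≥0∞} {σ s : ℝ} (h : s - σ + n * (recip q - recip r) ≠ 0) :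
    delta n r q s σ = 1 - delta n q r σ s := by
  have h' : σ - s + n * (recip r - recip q) = -(s - σ + n * (recip q - recip r)) := by ring
  rw [delta, delta, h', div_neg, ← neg_div, eq_sub_iff_add_eq, ← add_div, div_eq_one_iff_eq h]
  ring

end WienerBesov

open WienerBesov

theorem theorem2 {n : ℕ} (hn : 1 ≤ n)
    (φ : 𝓢(WienerBesov.Rn n, ℝ)) (hφ : WienerBesov.IsDyadicGenerator φ)
    (q r : ℝ≥0∞) (hqr : (0 < q ∧ q < 2 ∧ 2 < r) ∨ (0 < r ∧ r < 2 ∧ 2 < q))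
    (σ s : ℝ) (hσs : σ < s)
    (u v : WienerBesov.Rn n → ℝ) (hu : Measurable u) (hv : Measurable v)
    (huv : ∀ x, 1 ≤ u x * v x)
    (hq2 : q < 2 →
      σ - (n : ℝ) / 2 < n * (WienerBesov.recip q - 1 / 2) ∧ ∀ x, 1 ≤ u x)
    (hr2 : r < 2 →
      n * (WienerBesov.recip r - 1 / 2) < s - (n : ℝ) / 2 ∧ ∀ x, 1 ≤ v x)
    (hθ : 1 / 2 < (1 - WienerBesov.theta ((n : ℝ) / 2) σ s) * WienerBesov.recip q
      + WienerBesov.theta ((n : ℝ) / 2) σ s * WienerBesov.recip r) :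
    (∀ f : C₀(WienerBesov.Rn n, ℂ),
      WienerBesov.MemBesov φ q σ (WienerBesov.weightU 2 q r u) f →
      WienerBesov.MemBesov φ r s (WienerBesov.weightV 2 q r v) f →
      WienerBesov.MemWiener f) ∧
    (s - n * WienerBesov.recip r ≠ σ - n * WienerBesov.recip q →
      ∃ C : ℝ≥0, ∀ f : C₀(WienerBesov.Rn n, ℂ),
        WienerBesov.MemBesov φ q σ (WienerBesov.weightU 2 q r u) f →
        WienerBesov.MemBesov φ r s (WienerBesov.weightV 2 q r v) f →
        WienerBesov.wienerNorm f ≤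
          (C : ℝ≥0∞)
            * WienerBesov.besovNorm φ q σ (WienerBesov.weightU 2 q r u) f
                ^ (1 - WienerBesov.delta n q r σ s)
            * WienerBesov.besovNorm φ r s (WienerBesov.weightV 2 q r v) f
                ^ WienerBesov.delta n q r σ s) := by
  have hσs' : 0 < s - σ := sub_pos.2 hσs
  have hθ' : theta ((n : ℝ) / 2) σ s * (s - σ) = n / 2 - σ := div_mul_cancel₀ _ hσs'.ne'
  suffices h : ∃ C : ℝ≥0, ∀ f : C₀(WienerBesov.Rn n, ℂ),
      MemBesov φ q σ (weightU 2 q r u) f → MemBesov φ r s (weightV 2 q r v) f →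
      MemWiener f ∧ wienerNorm f ≤ C * besovNorm φ q σ (weightU 2 q r u) f ^ (1 - delta n q r σ s)
        * besovNorm φ r s (weightV 2 q r v) f ^ delta n q r σ s by
    obtain ⟨C, hC⟩ := h
    exact ⟨fun f hA hB => (hC f hA hB).1, fun _ => ⟨C, fun f hA hB => (hC f hA hB).2⟩⟩
  rcases hqr with ⟨hq, hq2', hr2'⟩ | ⟨hr, hr2', hq2'⟩
  · obtain ⟨η, hη0, hη1, hη⟩ := exists_interpolation_parameter hq hq2' hr2'
    obtain ⟨hσ, hu1⟩ := hq2 hq2'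
    have h1 := half_lt_recip hq hq2'
    have h2 := recip_lt_half hr2'
    -- The function `t ↦ (1-t)/q + t/r` is decreasing, exceeds `1/2` at `θ` and equals `1/2` at `η`.
    have hlt : theta ((n : ℝ) / 2) σ s < η := by
      by_contra hcon
      nlinarith
    refine exists_wienerNorm_le hn hφ hq hq2' hr2' hη0 hη1 hη (Or.inl ⟨by linarith, ?_⟩)
      hu hv hu1 huv
    nlinarith
  · obtain ⟨η, hη0, hη1, hη⟩ := exists_interpolation_parameter hr hr2' hq2'
    obtain ⟨hs, hv1⟩ := hr2 hr2'
    have h1 := half_lt_recip hr hr2'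
    have h2 := recip_lt_half hq2'
    -- Now `t ↦ (1-t)/q + t/r` is increasing and equals `1/2` at `t = 1 - η`, since `η` is attached
    -- to `q` here.
    have hlt : 1 - η < theta ((n : ℝ) / 2) σ s := by
      by_contra hcon
      nlinarith
    have he : 0 < (n : ℝ) / 2 - ((1 - η) * s + η * σ) := by nlinarith
    -- If this vanished, the exponents `n/r - s` and `n/2 - (1-η)s - ησ` would coincide, but the
    -- first is negative and the second positive.
    have hne : s - σ + n * (recip q - recip r) ≠ 0 := by
      intro h0
      have h3 : s - n * recip r = σ - n * recip q := by linear_combination h0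
      have h4 : (n : ℝ) / 2 - ((1 - η) * s + η * σ) = n * recip r - s := by
        linear_combination -(n : ℝ) * hη + η * h3
      linarith
    obtain ⟨C, hC⟩ := exists_wienerNorm_le hn hφ hr hr2' hq2' hη0 hη1 hη
      (σ := s) (s := σ) (Or.inr ⟨by linarith, he⟩) hv hu hv1
      (fun x => by rw [mul_comm]; exact huv x)
    refine ⟨C, fun f hA hB => ?_⟩
    have := hC f (by rwa [weightU_swap hr2' hq2']) (by rwa [weightV_swap hr2' hq2'])
    rw [weightU_swap hr2' hq2', weightV_swap hr2' hq2', delta_swap hne, sub_sub_cancel] at this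
    rwa [mul_right_comm] at this
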